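/- **Theorem 2 (quality of the transport map approximation).** Let $s>0$ and let $\mathbb B_s^d=\{x\in\mathbb R^d:\|x\|<s\}$ be the Poincaré ball, with Möbius addition $$x\oplus_s y=\frac{(1+\frac2{s^2}\langle x,y\rangle+\frac1{s^2}\|y\|^2)\,x+(1-\frac1{s^2}\|x\|^2)\,y}{1+\frac2{s^2}\langle x,y\rangle+\frac1{s^4}\|x\|^2\|y\|^2},$$ distance $d_s(x,y)=2s\tanh^{-1}(\|-x\oplus_s y\|/s)$, scalar multiplication $r\otimes_s x=s\tanh\!\big(r\tanh^{-1}(\|x\|/s)\big)\frac{x}{\|x\|}$, Lorentz factor $\gamma_x=(1-\|x\|^2/s^2)^{-1/2}$, and, for a matrix $\mathbf L\in\mathbb R^{d^t\times d^s}$, the hyperbolic linear layer $$\mathbf L^{\otimes_s}x=s\tanh\!\Big(\tfrac{\|\mathbf Lx\|}{\|x\|}\tanh^{-1}\tfrac{\|x\|}{s}\Big)\frac{\mathbf Lx}{\|\mathbf Lx\|}$$ (both products are $0$ where the direction vector is $0$). Let $C_x,C_y<s$, let $\mu^s,\mu^t$ be probability measures on $\mathbb B_s^{d^s}$, $\mathbb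 B_s^{d^t}$ concentrated on $\{\|x\|\le C_x\}$ and $\{\|y\|\le C_y\}$, let $T^*$ be a transport map from $\mu^s$ to $\mu^t$ (measurable, $T^*_\sharp\mu^s=\mu^t$), and let $\mathbf M_0$ be a coupling of $\mu^s$ and $\mu^t$, with gyrobarycenter map $$B^{\rm H}_{\mathbf M_0}(x)=\tfrac12\otimes_s\frac{\int\gamma_y^2\,y\;\mathbf M_0(dy\mid x)}{\int(\gamma_y^2-\frac12)\,\mathbf M_0(dy\mid x)}.$$ Let $\mathbf x_1,\dots,\mathbf x_n$ be i.i.d. with law $\mu^s$ ($n\ge1$). For target points $\mathbf x^t_1,\dots,\mathbf x^t_m$ with $\|\mathbf x^t_j\|\le C_y$ and a coupling matrix $\hat{\mathbf M}\in\Pi(\mathbf a,\mathbf b)=\{\mathbf M\in\mathbb R_+^{n\times m}:\mathbf M\mathbf 1=\mathbf a,\ \mathbf M^\top\mathbf 1=\mathbf b\}$ of probability vectors $\mathbf a,\mathbf b$ with $\mathbf a_i>0$ for all $i$, let $$B^{\rm H}_{\hat{\mathbf M}}(\mathbf x_i)=\tfrac12\otimes_s\frac{\sum_j\hat{\mathbf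 M}_{ij}\gamma_{\mathbf x_j^t}^2\,\mathbf x_j^t}{\sum_j\hat{\mathbf M}_{ij}(\gamma_{\mathbf x_j^t}^2-\frac12)} .$$ Fix $\omega>0$ and $\mathbf K\in\mathbb R^{d^t\times d^s}$, and call $T=\mathbf L^{\otimes_s}$ learned with $\hat{\mathbf M}$ if $\mathbf L$ minimizes $\frac1n\sum_i d_s(B^{\rm H}_{\hat{\mathbf M}}(\mathbf x_i),\mathbf L^{\otimes_s}\mathbf x_i)+\omega\|\mathbf L-\mathbf K\|_F^2$ over $\mathbb R^{d^t\times d^s}$. Then there is a constant $C$ depending only on $d^s,d^t,s,\omega,\mathbf K,C_x,C_y$ such that, for every $n\ge1$ and $\delta\in(0,1)$, with probability at least $1-\delta$ over the source sample, simultaneously for all such target points, $\mathbf a$, $\mathbf b$, $\hat{\mathbf M}$ and all maps $T$ learned with $\hat{\mathbf M}$, the two expectations below are finite and $$\mathbb E_{x\sim\mu^s}\big[d_s(T(x),T^*(x))\big]\le\frac1n\sum_{i=1}^n d_s\big(T(\mathbf x_i),B^{\rm H}_{\hat{\mathbf M}}(\mathbf x_i)\big)+\frac1n\sum_{i=1}^n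 d_s\big(B^{\rm H}_{\hat{\mathbf M}}(\mathbf x_i),B^{\rm H}_{\mathbf M_0}(\mathbf x_i)\big)+\mathbb E_{x\sim\mu^s}\big[d_s(T^*(x),B^{\rm H}_{\mathbf M_0}(x))\big]+C\,\frac{1+\sqrt{\ln(1/\delta)}}{\sqrt n}.$$ -/

import Mathlib

open MeasureTheory ProbabilityTheory
open scoped Matrix

noncomputable section

namespace HypOT

/-- The ambient Euclidean space `ℝ^d`. The Poincaré ball of radius `s` is `{x | ‖x‖ < s}`. -/
abbrev E (d : ℕ) : Type := EuclideanSpace ℝ (Fin d)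

/-- Möbius addition `x ⊕ₛ y` in the ball of radius `s`. -/
def mobAdd {d : ℕ} (s : ℝ) (x y : E d) : E d :=
  (1 + 2 / s ^ 2 * inner ℝ x y + ‖x‖ ^ 2 * ‖y‖ ^ 2 / s ^ 4)⁻¹ •
    ((1 + 2 / s ^ 2 * inner ℝ x y + ‖y‖ ^ 2 / s ^ 2) • x + (1 - ‖x‖ ^ 2 / s ^ 2) • y)

/-- Poincaré distance `dₛ(x, y) = 2 s artanh (‖(-x) ⊕ₛ y‖ / s)`. -/
def pdist {d : ℕ} (s : ℝ) (x y : E d) : ℝ :=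
  2 * s * Real.artanh (‖mobAdd s (-x) y‖ / s)

/-- Möbius scalar multiplication `r ⊗ₛ x` (equal to `0` at `x = 0`). -/
def mobSMul {d : ℕ} (s r : ℝ) (x : E d) : E d :=
  (s * Real.tanh (r * Real.artanh (‖x‖ / s)) / ‖x‖) • x

/-- The matrix-vector product `L x` on Euclidean spaces. -/
def matVec {dt ds : ℕ} (L : Matrix (Fin dt) (Fin ds) ℝ) (x : E ds) : E dt :=
  WithLp.toLp 2 (L *ᵥ x.ofLp)

/-- The hyperbolic linear layer `x ↦ L^{⊗ₛ} x`, Möbius matrix-vector multiplication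
(equal to `0` where `L x = 0`). -/
def mobLayer {dt ds : ℕ} (s : ℝ) (L : Matrix (Fin dt) (Fin ds) ℝ) (x : E ds) : E dt :=
  (s * Real.tanh (‖matVec L x‖ / ‖x‖ * Real.artanh (‖x‖ / s)) / ‖matVec L x‖) • matVec L x

/-- Lorentz gamma factor `(1 - ‖x‖² / s²)^(-1/2)`. -/
def gammaFactor {d : ℕ} (s : ℝ) (x : E d) : ℝ :=
  (√(1 - ‖x‖ ^ 2 / s ^ 2))⁻¹

/-- The set `Π(a, b)` of discrete couplings of the weight vectors `a` and `b`. -/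
def couplings {n m : ℕ} (a : Fin n → ℝ) (b : Fin m → ℝ) : Set (Matrix (Fin n) (Fin m) ℝ) :=
  {M | (∀ i j, 0 ≤ M i j) ∧ (∀ i, ∑ j, M i j = a i) ∧ ∀ j, ∑ i, M i j = b j}

/-- Empirical gyrobarycenter map: the image of the `i`-th source sample, that is, the `i`-th row of
`(1/2) ⊗ₛ diag(M g)⁻¹ M G Xᵗ` with `g = γ² - 1/2` and `G = diag(γ²)`. -/
def gyroBary {n m d : ℕ} (s : ℝ) (M : Matrix (Fin n) (Fin m) ℝ) (Xt : Fin m → E d)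
    (i : Fin n) : E d :=
  mobSMul s (1 / 2)
    ((∑ j, M i j * (gammaFactor s (Xt j) ^ 2 - 1 / 2))⁻¹ •
      ∑ j, (M i j * gammaFactor s (Xt j) ^ 2) • Xt j)

/-- Population gyrobarycenter map of a coupling `M₀` of two probability measures: the same formula,
with the normalized row of the coupling matrix at a source point `x` replaced by the conditional
law `M₀(· | x)` of the target given the source. -/
def gyroBaryPop {ds dt : ℕ} (s : ℝ) (M₀ : Measure (E ds × E dt)) [IsFiniteMeasure M₀]
    (x : E ds) : E dt :=
  mobSMul s (1 / 2)
    ((∫ y, (gammaFactor s y ^ 2 - 1 / 2) ∂(M₀.condKernel x))⁻¹ •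
      ∫ y, gammaFactor s y ^ 2 • y ∂(M₀.condKernel x))

/-- Fitting term `lᴴ(T, B_M)` plus the regularizer `ω ‖L - K‖_F²`, for `T = L^{⊗ₛ}`. -/
def qualityLoss {n m ds dt : ℕ} (s ω : ℝ) (K : Matrix (Fin dt) (Fin ds) ℝ)
    (X : Fin n → E ds) (Xt : Fin m → E dt) (M : Matrix (Fin n) (Fin m) ℝ)
    (L : Matrix (Fin dt) (Fin ds) ℝ) : ℝ :=
  1 / (n : ℝ) * ∑ i, pdist s (gyroBary s M Xt i) (mobLayer s L (X i))
    + ω * ∑ p, ∑ q, (L p q - K p q) ^ 2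

/-- `L` is learned from the samples with the coupling `M`: it minimizes the quality loss. If `(M, L)`
minimizes that loss plus a term depending on `M` only (the regularized transport loss),
jointly or alternately, then `L` has this property. -/
def IsLearned {n m ds dt : ℕ} (s ω : ℝ) (K : Matrix (Fin dt) (Fin ds) ℝ)
    (X : Fin n → E ds) (Xt : Fin m → E dt) (M : Matrix (Fin n) (Fin m) ℝ)
    (L : Matrix (Fin dt) (Fin ds) ℝ) : Prop :=
  ∀ L' : Matrix (Fin dt) (Fin ds) ℝ, qualityLoss s ω K X Xt M L ≤ qualityLoss s ω K X Xt M L'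

end HypOT

end

/-!
Comparing the losses of `L` and `K`, the regularizer confines every learned matrix to a Frobenius
ball around `K` whose radius depends on the fixed data only. The triangle inequality through the
gyrobarycenter map, applied both to the expectation and to the empirical mean, then reduces the
bound to the uniform deviation between expectation and empirical mean of
`x ↦ pdist s (mobLayer s L x) (B x)` over that ball, where `B` is the population gyrobarycenter map.

A layer is `expZero s ∘ L ∘ logZero s`, so these functions are bounded, and Lipschitz in `L`,
uniformly in `‖x‖ ≤ Cx`. A ball in a finite-dimensional space has nets of precision `2⁻ᵏ` and size
`Mᵏ`, and chaining Hoeffding's inequality along them sums to `O(1 / √n)` without a logarithmic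
factor.

The triangle inequality for `pdist` is read off the hyperboloid model, where it is the
Cauchy-Schwarz inequality for the Lorentz form on the orthogonal complement of a unit timelike
vector.
-/

noncomputable section

namespace HypOT

section Tanh

theorem hasDerivAt_tanh (x : ℝ) : HasDerivAt Real.tanh (1 / Real.cosh x ^ 2) x := by
  have h := (Real.hasDerivAt_sinh x).div (Real.hasDerivAt_cosh x) (Real.cosh_pos x).ne'
  rw [← sq, ← sq, Real.cosh_sq_sub_sinh_sq] at h
  rwa [funext Real.tanh_eq_sinh_div_cosh]

theorem lipschitzWith_tanh : LipschitzWith 1 Real.tanh := by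
  refine lipschitzWith_of_nnnorm_deriv_le (fun x => (hasDerivAt_tanh x).differentiableAt)
    fun x => ?_
  rw [(hasDerivAt_tanh x).deriv, ← NNReal.coe_le_coe, coe_nnnorm, NNReal.coe_one,
    Real.norm_of_nonneg (by positivity), div_le_one (by positivity)]
  exact one_le_pow₀ (Real.one_le_cosh x)

theorem monotone_tanh : Monotone Real.tanh :=
  monotone_of_hasDerivAt_nonneg hasDerivAt_tanh fun x => by positivity

theorem tanh_nonneg {x : ℝ} (hx : 0 ≤ x) : 0 ≤ Real.tanh x := by
  simpa using monotone_tanh hx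

theorem abs_tanh_sub_tanh_le (x y : ℝ) : |Real.tanh x - Real.tanh y| ≤ |x - y| := by
  simpa [Real.dist_eq] using lipschitzWith_tanh.dist_le_mul x y

theorem tanh_le_self {x : ℝ} (hx : 0 ≤ x) : Real.tanh x ≤ x := by
  simpa [abs_of_nonneg, hx, tanh_nonneg] using abs_tanh_sub_tanh_le x 0

theorem tanh_two_mul (x : ℝ) :
    Real.tanh (2 * x) = 2 * Real.tanh x / (1 + Real.tanh x ^ 2) := by
  have := Real.cosh_pos x
  rw [Real.tanh_eq_sinh_div_cosh, Real.tanh_eq_sinh_div_cosh, Real.sinh_two_mul,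
    Real.cosh_two_mul]
  field_simp

theorem measurable_artanh : Measurable Real.artanh := by
  unfold Real.artanh
  fun_prop

end Tanh

section LorentzForm

variable {V : Type*} [NormedAddCommGroup V] [InnerProductSpace ℝ V]

/-- The Lorentz form `x₀ y₀ - ⟪x, y⟫` on `V × ℝ`, with the time coordinate in the second factor. -/
def lorentzForm : LinearMap.BilinForm ℝ (V × ℝ) :=
  (LinearMap.mul ℝ ℝ).compl₁₂ (LinearMap.snd ℝ V ℝ) (LinearMap.snd ℝ V ℝ) -
    (innerₗ V).compl₁₂ (LinearMap.fst ℝ V ℝ) (LinearMap.fst ℝ V ℝ)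

theorem lorentzForm_apply (p q : V × ℝ) : lorentzForm p q = p.2 * q.2 - inner ℝ p.1 q.1 := by
  simp [lorentzForm]

theorem lorentzForm_comm (p q : V × ℝ) : lorentzForm p q = lorentzForm q p := by
  rw [lorentzForm_apply, lorentzForm_apply, mul_comm, real_inner_comm]

theorem lorentzForm_self_nonpos {u w : V × ℝ} (hu : lorentzForm u u = 1)
    (hw : lorentzForm w u = 0) : lorentzForm w w ≤ 0 := by
  rw [lorentzForm_apply, ← sq, real_inner_self_eq_norm_sq] at hu ⊢
  rw [lorentzForm_apply, sub_eq_zero] at hw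
  have hcs : (w.2 * u.2) ^ 2 ≤ (‖w.1‖ * ‖u.1‖) ^ 2 := by
    rw [hw]
    exact sq_le_sq.2 ((abs_real_inner_le_norm _ _).trans (le_abs_self _))
  nlinarith [sq_nonneg ‖w.1‖, sq_nonneg ‖u.1‖]

/-- The form is negative semidefinite on `vᗮ`, so Cauchy-Schwarz applies to the components of
`u` and `w` orthogonal to `v`. -/
theorem sq_lorentzForm_sub_le {u v w : V × ℝ} (hu : lorentzForm u u = 1)
    (hv : lorentzForm v v = 1) (hw : lorentzForm w w = 1) :
    (lorentzForm u w - lorentzForm u v * lorentzForm v w) ^ 2 ≤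
      (lorentzForm u v ^ 2 - 1) * (lorentzForm v w ^ 2 - 1) := by
  have hquad : ∀ t : ℝ, 0 ≤ (lorentzForm v w ^ 2 - 1) * (t * t) +
      2 * (lorentzForm u v * lorentzForm v w - lorentzForm u w) * t +
      (lorentzForm u v ^ 2 - 1) := fun t => by
    have h := lorentzForm_self_nonpos (w := (u + t • w) - lorentzForm (u + t • w) v • v) hv
      (by simp [hv])
    simp only [map_add, map_sub, map_smul, LinearMap.add_apply, LinearMap.sub_apply,
      LinearMap.smul_apply, smul_eq_mul, hu, hv, hw, lorentzForm_comm w, lorentzForm_comm v u] at h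
    linarith
  have h := discrim_le_zero hquad
  rw [discrim] at h
  linarith

end LorentzForm

section PoincareBall

variable {d : ℕ} {s ρ : ℝ} {x y z : E d}

theorem one_sub_sq_div_sq_pos (h0 : 0 ≤ ρ) (hρ : ρ < s) : 0 < 1 - ρ ^ 2 / s ^ 2 := by
  have hs := h0.trans_lt hρ
  rw [sub_pos, ← div_pow, sq_lt_one_iff₀ (by positivity)]
  exact (div_lt_one hs).2 hρ

theorem gammaFactor_sq (hx : ‖x‖ < s) :
    gammaFactor s x ^ 2 = (1 - ‖x‖ ^ 2 / s ^ 2)⁻¹ := by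
  rw [gammaFactor, inv_pow, Real.sq_sqrt (one_sub_sq_div_sq_pos (norm_nonneg x) hx).le]

theorem norm_sq_eq (hs : 0 < s) (hx : ‖x‖ < s) :
    ‖x‖ ^ 2 = s ^ 2 * (1 - (gammaFactor s x ^ 2)⁻¹) := by
  rw [gammaFactor_sq hx, inv_inv]
  field_simp
  ring

theorem gammaFactor_pos (hx : ‖x‖ < s) : 0 < gammaFactor s x :=
  inv_pos.2 (Real.sqrt_pos.2 (one_sub_sq_div_sq_pos (norm_nonneg x) hx))

theorem mobAdd_neg_denom_eq (hs : 0 < s) (hx : ‖x‖ < s) (hy : ‖y‖ < s) :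
    1 + 2 / s ^ 2 * inner ℝ (-x) y + ‖-x‖ ^ 2 * ‖y‖ ^ 2 / s ^ 4 =
      (1 + (gammaFactor s x * gammaFactor s y * ‖x - y‖ / s) ^ 2) /
        (gammaFactor s x * gammaFactor s y) ^ 2 := by
  have := gammaFactor_pos hx
  have := gammaFactor_pos hy
  rw [div_pow, mul_pow _ ‖x - y‖, norm_sub_sq_real, inner_neg_left, norm_neg,
    norm_sq_eq hs hx, norm_sq_eq hs hy]
  field_simp
  ring

theorem norm_mobAdd_neg_div_sq (hs : 0 < s) (hx : ‖x‖ < s) (hy : ‖y‖ < s) :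
    (‖mobAdd s (-x) y‖ / s) ^ 2 = (gammaFactor s x * gammaFactor s y * ‖x - y‖ / s) ^ 2 /
      (1 + (gammaFactor s x * gammaFactor s y * ‖x - y‖ / s) ^ 2) := by
  have := gammaFactor_pos hx
  have := gammaFactor_pos hy
  rw [mobAdd, mobAdd_neg_denom_eq hs hx hy, norm_smul]
  set q := (gammaFactor s x * gammaFactor s y * ‖x - y‖ / s) ^ 2 with hq
  have hq0 : 0 ≤ q := sq_nonneg _
  have hnum : ‖(1 + 2 / s ^ 2 * inner ℝ (-x) y + ‖y‖ ^ 2 / s ^ 2) • -x +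
      (1 - ‖-x‖ ^ 2 / s ^ 2) • y‖ ^ 2 =
      s ^ 2 * q * (1 + q) / (gammaFactor s x * gammaFactor s y) ^ 4 := by
    rw [norm_add_sq_real, norm_smul, norm_smul, inner_smul_left, inner_smul_right, hq, div_pow,
      mul_pow _ ‖x - y‖, norm_sub_sq_real]
    simp only [mul_pow, Real.norm_eq_abs, sq_abs, conj_trivial, norm_neg, inner_neg_left]
    rw [norm_sq_eq hs hx, norm_sq_eq hs hy]
    field_simp
    ring
  rw [div_pow, mul_pow, hnum, Real.norm_eq_abs, sq_abs]
  field_simp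

theorem norm_mobAdd_neg_div_mem_Ico (hs : 0 < s) (hx : ‖x‖ < s) (hy : ‖y‖ < s) :
    ‖mobAdd s (-x) y‖ / s ∈ Set.Ico (0 : ℝ) 1 := by
  refine ⟨by positivity, ?_⟩
  rw [← sq_lt_one_iff₀ (by positivity), norm_mobAdd_neg_div_sq hs hx hy,
    div_lt_one (by positivity)]
  linarith

theorem pdist_nonneg (hs : 0 ≤ s) (x y : E d) : 0 ≤ pdist s x y :=
  mul_nonneg (by positivity) (Real.artanh_nonneg (by positivity))

theorem sinh_pdist_div_two_mul (hs : 0 < s) (hx : ‖x‖ < s) (hy : ‖y‖ < s) :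
    Real.sinh (pdist s x y / (2 * s)) = gammaFactor s x * gammaFactor s y * ‖x - y‖ / s := by
  obtain ⟨h0, h1⟩ := norm_mobAdd_neg_div_mem_Ico hs hx hy
  have := gammaFactor_pos hx
  have := gammaFactor_pos hy
  rw [pdist, mul_div_cancel_left₀ _ (by positivity), Real.sinh_artanh ⟨by linarith, h1⟩,
    ← sq_eq_sq₀ (by positivity) (by positivity), div_pow, Real.sq_sqrt (by nlinarith),
    norm_mobAdd_neg_div_sq hs hx hy]
  field_simp
  ring

theorem pdist_comm (hs : 0 < s) (hx : ‖x‖ < s) (hy : ‖y‖ < s) : pdist s x y = pdist s y x := by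
  rw [← div_left_inj' (by positivity : 2 * s ≠ 0), ← Real.sinh_injective.eq_iff,
    sinh_pdist_div_two_mul hs hx hy, sinh_pdist_div_two_mul hs hy hx, norm_sub_rev,
    mul_comm (gammaFactor s x)]

/-- The point of the hyperboloid model corresponding to the point `x` of the Poincaré ball; it
turns hyperbolic distances into values of the Lorentz form. -/
def hyperboloidLift (s : ℝ) (x : E d) : E d × ℝ :=
  ((2 * gammaFactor s x ^ 2 / s) • x, 2 * gammaFactor s x ^ 2 - 1)

theorem lorentzForm_hyperboloidLift (hs : 0 < s) (hx : ‖x‖ < s) (hy : ‖y‖ < s) :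
    lorentzForm (hyperboloidLift s x) (hyperboloidLift s y) =
      1 + 2 * (gammaFactor s x * gammaFactor s y * ‖x - y‖ / s) ^ 2 := by
  have := gammaFactor_pos hx
  have := gammaFactor_pos hy
  rw [lorentzForm_apply, hyperboloidLift, hyperboloidLift, real_inner_smul_left,
    inner_smul_right, div_pow, mul_pow _ ‖x - y‖, norm_sub_sq_real, norm_sq_eq hs hx,
    norm_sq_eq hs hy]
  field_simp
  ring

theorem lorentzForm_hyperboloidLift_self (hs : 0 < s) (hx : ‖x‖ < s) :
    lorentzForm (hyperboloidLift s x) (hyperboloidLift s x) = 1 := by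
  simp [lorentzForm_hyperboloidLift hs hx hx]

theorem cosh_pdist_div (hs : 0 < s) (hx : ‖x‖ < s) (hy : ‖y‖ < s) :
    Real.cosh (pdist s x y / s) =
      lorentzForm (hyperboloidLift s x) (hyperboloidLift s y) := by
  rw [lorentzForm_hyperboloidLift hs hx hy, ← sinh_pdist_div_two_mul hs hx hy,
    show pdist s x y / s = 2 * (pdist s x y / (2 * s)) by field_simp, Real.cosh_two_mul,
    Real.cosh_sq]
  ring

theorem pdist_triangle (hs : 0 < s) (hx : ‖x‖ < s) (hy : ‖y‖ < s) (hz : ‖z‖ < s) :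
    pdist s x z ≤ pdist s x y + pdist s y z := by
  have hnonneg : ∀ u v : E d, 0 ≤ pdist s u v / s := fun u v =>
    div_nonneg (pdist_nonneg hs.le u v) hs.le
  have hform := sq_lorentzForm_sub_le (lorentzForm_hyperboloidLift_self hs hx)
    (lorentzForm_hyperboloidLift_self hs hy) (lorentzForm_hyperboloidLift_self hs hz)
  rw [← cosh_pdist_div hs hx hy, ← cosh_pdist_div hs hy hz, ← cosh_pdist_div hs hx hz,
    ← Real.sinh_sq, ← Real.sinh_sq, ← mul_pow] at hform
  have hcosh : Real.cosh (pdist s x z / s) ≤ Real.cosh (pdist s x y / s + pdist s y z / s) := by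
    rw [Real.cosh_add]
    exact sub_le_iff_le_add'.1 (le_of_sq_le_sq hform
      (mul_nonneg (Real.sinh_nonneg_iff.2 (hnonneg x y)) (Real.sinh_nonneg_iff.2 (hnonneg y z))))
  rwa [Real.cosh_le_cosh, abs_of_nonneg (hnonneg x z),
    abs_of_nonneg (add_nonneg (hnonneg x y) (hnonneg y z)), ← add_div,
    div_le_div_iff_of_pos_right hs] at hcosh

theorem abs_pdist_sub_pdist_le (hs : 0 < s) (hx : ‖x‖ < s) (hy : ‖y‖ < s) (hz : ‖z‖ < s) :
    |pdist s x z - pdist s y z| ≤ pdist s x y := by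
  have h₁ := pdist_triangle hs hx hy hz
  have h₂ := pdist_triangle hs hy hx hz
  rw [pdist_comm hs hy hx] at h₂
  exact abs_sub_le_iff.2 ⟨by linarith, by linarith⟩

theorem pdist_le_gammaFactor_mul (hs : 0 < s) (hx : ‖x‖ < s) (hy : ‖y‖ < s) :
    pdist s x y ≤ 2 * (gammaFactor s x * gammaFactor s y) * ‖x - y‖ := by
  have h := Real.self_le_sinh_iff.2
    (div_nonneg (pdist_nonneg hs.le x y) (mul_pos two_pos hs).le)
  rw [sinh_pdist_div_two_mul hs hx hy, div_le_div_iff₀ (by positivity) hs] at h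
  refine le_of_mul_le_mul_right (h.trans_eq ?_) hs
  ring

theorem gammaFactor_le (hρ : ρ < s) (hx : ‖x‖ ≤ ρ) :
    gammaFactor s x ≤ (√(1 - ρ ^ 2 / s ^ 2))⁻¹ := by
  have := Real.sqrt_pos.2 (one_sub_sq_div_sq_pos ((norm_nonneg x).trans hx) hρ)
  unfold gammaFactor
  gcongr

/-- The Lipschitz constant of the Poincaré distance with respect to the Euclidean one on the ball
of radius `ρ`. -/
def pdistLip (s ρ : ℝ) : ℝ := 2 / (1 - ρ ^ 2 / s ^ 2)

theorem pdistLip_nonneg (h0 : 0 ≤ ρ) (hρ : ρ < s) : 0 ≤ pdistLip s ρ :=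
  div_nonneg zero_le_two (one_sub_sq_div_sq_pos h0 hρ).le

theorem pdist_le_pdistLip_mul (hs : 0 < s) (hρ : ρ < s) (hx : ‖x‖ ≤ ρ) (hy : ‖y‖ ≤ ρ) :
    pdist s x y ≤ pdistLip s ρ * ‖x - y‖ := by
  have hx' := hx.trans_lt hρ
  have hy' := hy.trans_lt hρ
  have hle := mul_le_mul (gammaFactor_le hρ hx) (gammaFactor_le hρ hy)
    (gammaFactor_pos hy').le (by positivity)
  calc pdist s x y ≤ 2 * (gammaFactor s x * gammaFactor s y) * ‖x - y‖ :=
        pdist_le_gammaFactor_mul hs hx' hy'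
    _ ≤ 2 * ((√(1 - ρ ^ 2 / s ^ 2))⁻¹ * (√(1 - ρ ^ 2 / s ^ 2))⁻¹) * ‖x - y‖ := by gcongr
    _ = pdistLip s ρ * ‖x - y‖ := by
        rw [← mul_inv,
          Real.mul_self_sqrt (one_sub_sq_div_sq_pos ((norm_nonneg x).trans hx) hρ).le, pdistLip,
          ← div_eq_mul_inv]

theorem pdist_le_pdistLip_mul_two_mul (hs : 0 < s) (hρ : ρ < s) (hx : ‖x‖ ≤ ρ)
    (hy : ‖y‖ ≤ ρ) : pdist s x y ≤ pdistLip s ρ * (2 * ρ) := by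
  refine (pdist_le_pdistLip_mul hs hρ hx hy).trans
    (mul_le_mul_of_nonneg_left ?_ (pdistLip_nonneg ((norm_nonneg x).trans hx) hρ))
  linarith [norm_sub_le x y]

theorem measurable_pdist (s : ℝ) : Measurable fun p : E d × E d => pdist s p.1 p.2 := by
  have h : Measurable fun p : E d × E d => ‖mobAdd s (-p.1) p.2‖ / s := by
    unfold mobAdd
    fun_prop
  exact (measurable_artanh.comp h).const_mul (2 * s)

theorem aemeasurable_pdist {Ω : Type*} [MeasurableSpace Ω] {μ : Measure Ω} (s : ℝ)
    {f g : Ω → E d} (hf : AEMeasurable f μ) (hg : AEMeasurable g μ) :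
    AEMeasurable (fun ω => pdist s (f ω) (g ω)) μ := by
  simpa only [Function.comp_def] using (measurable_pdist s).comp_aemeasurable (hf.prodMk hg)

theorem integrable_pdist {Ω : Type*} [MeasurableSpace Ω] {μ : Measure Ω} [IsFiniteMeasure μ]
    (hs : 0 < s) (hρ : ρ < s) {f g : Ω → E d} (hf : AEMeasurable f μ) (hg : AEMeasurable g μ)
    (hfρ : ∀ᵐ ω ∂μ, ‖f ω‖ ≤ ρ) (hgρ : ∀ᵐ ω ∂μ, ‖g ω‖ ≤ ρ) :
    Integrable (fun ω => pdist s (f ω) (g ω)) μ := by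
  refine Integrable.of_bound (aemeasurable_pdist s hf hg).aestronglyMeasurable
    (pdistLip s ρ * (2 * ρ)) ?_
  filter_upwards [hfρ, hgρ] with ω hω₁ hω₂
  rw [Real.norm_of_nonneg (pdist_nonneg hs.le _ _)]
  exact pdist_le_pdistLip_mul_two_mul hs hρ hω₁ hω₂

end PoincareBall

section Exponential

variable {V : Type*} [NormedAddCommGroup V] [NormedSpace ℝ V] {s ρ : ℝ}

theorem norm_smul_normalize_le (c : ℝ) (v : V) : ‖c • NormedSpace.normalize v‖ ≤ |c| := by
  rw [NormedSpace.normalize, norm_smul, norm_smul, norm_inv, norm_norm]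
  exact mul_le_of_le_one_right (abs_nonneg c) inv_mul_le_one

theorem norm_mul_norm_normalize_sub_le (u v : V) :
    ‖v‖ * ‖NormedSpace.normalize u - NormedSpace.normalize v‖ ≤ 2 * ‖u - v‖ := by
  have hsplit : ‖v‖ • (NormedSpace.normalize u - NormedSpace.normalize v) =
      (‖v‖ - ‖u‖) • NormedSpace.normalize u + (u - v) := by
    rw [smul_sub, sub_smul, NormedSpace.norm_smul_normalize, NormedSpace.norm_smul_normalize]
    abel
  have hradial : ‖(‖v‖ - ‖u‖) • NormedSpace.normalize u‖ ≤ ‖u - v‖ := by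
    rw [norm_sub_rev u]
    exact (norm_smul_normalize_le _ u).trans (abs_norm_sub_norm_le v u)
  calc ‖v‖ * ‖NormedSpace.normalize u - NormedSpace.normalize v‖
      = ‖(‖v‖ - ‖u‖) • NormedSpace.normalize u + (u - v)‖ := by
        rw [← hsplit, norm_smul, norm_norm]
    _ ≤ 2 * ‖u - v‖ := by linarith [norm_add_le ((‖v‖ - ‖u‖) • NormedSpace.normalize u) (u - v)]

/-- The exponential map of the Poincaré ball at the origin, up to a factor `2` in the argument:
`v ↦ s tanh ‖v‖ v / ‖v‖`. -/
def expZero (s : ℝ) (v : V) : V := (s * Real.tanh ‖v‖) • NormedSpace.normalize v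

/-- The logarithmic map of the Poincaré ball at the origin, inverse to `expZero` on the ball. -/
def logZero (s : ℝ) (x : V) : V := (Real.artanh (‖x‖ / s) / ‖x‖) • x

theorem norm_expZero_le (hs : 0 ≤ s) (v : V) : ‖expZero s v‖ ≤ s * Real.tanh ‖v‖ := by
  rw [← abs_of_nonneg (mul_nonneg hs (tanh_nonneg (norm_nonneg v)))]
  exact norm_smul_normalize_le _ v

theorem norm_expZero_sub_le (hs : 0 ≤ s) (u v : V) :
    ‖expZero s u - expZero s v‖ ≤ 3 * s * ‖u - v‖ := by
  have hradial : ‖(Real.tanh ‖u‖ - Real.tanh ‖v‖) • NormedSpace.normalize u‖ ≤ ‖u - v‖ :=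
    (norm_smul_normalize_le _ u).trans
      ((abs_tanh_sub_tanh_le _ _).trans (abs_norm_sub_norm_le u v))
  have hangular : ‖Real.tanh ‖v‖ • (NormedSpace.normalize u - NormedSpace.normalize v)‖ ≤
      2 * ‖u - v‖ := by
    rw [norm_smul, Real.norm_of_nonneg (tanh_nonneg (norm_nonneg v))]
    exact (mul_le_mul_of_nonneg_right (tanh_le_self (norm_nonneg v)) (norm_nonneg _)).trans
      (norm_mul_norm_normalize_sub_le u v)
  calc ‖expZero s u - expZero s v‖
      = ‖s • ((Real.tanh ‖u‖ - Real.tanh ‖v‖) • NormedSpace.normalize u +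
          Real.tanh ‖v‖ • (NormedSpace.normalize u - NormedSpace.normalize v))‖ := by
        rw [expZero, expZero, mul_smul, mul_smul, ← smul_sub, sub_smul, smul_sub (Real.tanh _),
          sub_add_sub_cancel]
    _ ≤ s * (‖u - v‖ + 2 * ‖u - v‖) := by
        rw [norm_smul, Real.norm_of_nonneg hs]
        gcongr
        exact (norm_add_le _ _).trans (add_le_add hradial hangular)
    _ = 3 * s * ‖u - v‖ := by ring

theorem norm_logZero_le (hs : 0 < s) (hρ : ρ < s) {x : V} (hx : ‖x‖ ≤ ρ) :
    ‖logZero s x‖ ≤ Real.artanh (ρ / s) := by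
  have h0 : 0 ≤ ‖x‖ / s := by positivity
  have hA := Real.artanh_nonneg h0
  rw [logZero, norm_smul, Real.norm_of_nonneg (by positivity), div_mul_eq_mul_div]
  exact (div_le_of_le_mul₀ (norm_nonneg _) hA le_rfl).trans
    (Real.artanh_le_artanh (by linarith) ((div_lt_one hs).2 hρ) (by gcongr))

end Exponential

section Layer

open scoped Matrix.Norms.Frobenius

variable {ds dt : ℕ} {s ρ : ℝ} {x : E ds}

theorem frobenius_norm_sq {m n : Type*} [Fintype m] [Fintype n] (A : Matrix m n ℝ) :
    ‖A‖ ^ 2 = ∑ i, ∑ j, A i j ^ 2 := by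
  rw [Matrix.frobenius_norm_def, ← Real.sqrt_eq_rpow]
  simp only [Real.rpow_two, Real.norm_eq_abs, sq_abs]
  exact Real.sq_sqrt (by positivity)

theorem norm_matVec_le (L : Matrix (Fin dt) (Fin ds) ℝ) (x : E ds) :
    ‖matVec L x‖ ≤ ‖L‖ * ‖x‖ := by
  have h := Matrix.frobenius_norm_mul L (Matrix.replicateCol Unit x.ofLp)
  rwa [← Matrix.replicateCol_mulVec, Matrix.frobenius_norm_replicateCol,
    Matrix.frobenius_norm_replicateCol] at h

theorem matVec_smul (L : Matrix (Fin dt) (Fin ds) ℝ) (c : ℝ) (x : E ds) :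
    matVec L (c • x) = c • matVec L x := by
  simp [matVec, Matrix.mulVec_smul]

theorem matVec_sub_matVec (L L' : Matrix (Fin dt) (Fin ds) ℝ) (x : E ds) :
    matVec L x - matVec L' x = matVec (L - L') x := by
  simp [matVec, Matrix.sub_mulVec]

theorem mobLayer_eq_expZero (hs : 0 < s) (L : Matrix (Fin dt) (Fin ds) ℝ) (x : E ds) :
    mobLayer s L x = expZero s (matVec L (logZero s x)) := by
  have hA : 0 ≤ Real.artanh (‖x‖ / s) := Real.artanh_nonneg (by positivity)
  have hc : 0 ≤ Real.artanh (‖x‖ / s) / ‖x‖ := by positivity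
  rw [logZero, matVec_smul, mobLayer, expZero, norm_smul, Real.norm_of_nonneg hc,
    div_mul_comm ‖matVec L x‖]
  rcases hc.eq_or_lt with hc | hc
  · simp [← hc]
  · rw [NormedSpace.normalize_smul_of_pos hc, NormedSpace.normalize, smul_smul, div_eq_mul_inv]

theorem norm_mobLayer_le (hs : 0 < s) (hρ : ρ < s) {F : ℝ} {L : Matrix (Fin dt) (Fin ds) ℝ}
    (hL : ‖L‖ ≤ F) (hx : ‖x‖ ≤ ρ) :
    ‖mobLayer s L x‖ ≤ s * Real.tanh (F * Real.artanh (ρ / s)) := by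
  rw [mobLayer_eq_expZero hs]
  refine (norm_expZero_le hs.le _).trans
    (mul_le_mul_of_nonneg_left (monotone_tanh ((norm_matVec_le _ _).trans ?_)) hs.le)
  exact mul_le_mul hL (norm_logZero_le hs hρ hx) (norm_nonneg _) ((norm_nonneg _).trans hL)

theorem norm_mobLayer_sub_le (hs : 0 < s) (hρ : ρ < s) (L L' : Matrix (Fin dt) (Fin ds) ℝ)
    (hx : ‖x‖ ≤ ρ) :
    ‖mobLayer s L x - mobLayer s L' x‖ ≤ 3 * s * Real.artanh (ρ / s) * ‖L - L'‖ := by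
  rw [mobLayer_eq_expZero hs, mobLayer_eq_expZero hs]
  calc ‖expZero s (matVec L (logZero s x)) - expZero s (matVec L' (logZero s x))‖
      ≤ 3 * s * ‖matVec L (logZero s x) - matVec L' (logZero s x)‖ :=
        norm_expZero_sub_le hs.le _ _
    _ ≤ 3 * s * (‖L - L'‖ * Real.artanh (ρ / s)) := by
        rw [matVec_sub_matVec]
        gcongr
        exact (norm_matVec_le _ _).trans
          (mul_le_mul_of_nonneg_left (norm_logZero_le hs hρ hx) (norm_nonneg _))
    _ = 3 * s * Real.artanh (ρ / s) * ‖L - L'‖ := by ring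

theorem measurable_mobLayer (s : ℝ) (L : Matrix (Fin dt) (Fin ds) ℝ) :
    Measurable (mobLayer s L : E ds → E dt) := by
  have hL : Measurable (matVec L : E ds → E dt) := by
    unfold matVec
    fun_prop
  have hA : Measurable fun x : E ds => Real.artanh (‖x‖ / s) :=
    measurable_artanh.comp (by fun_prop)
  have hT : Measurable fun x : E ds =>
      Real.tanh (‖matVec L x‖ / ‖x‖ * Real.artanh (‖x‖ / s)) :=
    lipschitzWith_tanh.continuous.measurable.comp (by fun_prop)
  unfold mobLayer
  fun_prop

end Layer

section Gyrobarycenter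

variable {ds dt d n m : ℕ} {s C : ℝ}

theorem mobSMul_eq_smul_normalize (s r : ℝ) (x : E d) :
    mobSMul s r x = (s * Real.tanh (r * Real.artanh (‖x‖ / s))) • NormedSpace.normalize x := by
  rw [mobSMul, NormedSpace.normalize, smul_smul, div_eq_mul_inv]

theorem measurable_mobSMul (s r : ℝ) : Measurable (mobSMul s r : E d → E d) := by
  have hA : Measurable fun x : E d => Real.artanh (‖x‖ / s) :=
    measurable_artanh.comp (by fun_prop)
  have hT : Measurable fun x : E d => Real.tanh (r * Real.artanh (‖x‖ / s)) :=
    lipschitzWith_tanh.continuous.measurable.comp (by fun_prop)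
  unfold mobSMul
  fun_prop

theorem norm_mobSMul_half_le (h0 : 0 ≤ C) (hC : C < s) {v : E d}
    (hv : ‖v‖ ≤ s * Real.tanh (2 * Real.artanh (C / s))) : ‖mobSMul s (1 / 2) v‖ ≤ C := by
  have hs := h0.trans_lt hC
  have hv0 : 0 ≤ ‖v‖ / s := by positivity
  have hv' : ‖v‖ / s ≤ Real.tanh (2 * Real.artanh (C / s)) := (div_le_iff₀' hs).2 hv
  have hA : 1 / 2 * Real.artanh (‖v‖ / s) ≤ Real.artanh (C / s) := by
    have h := Real.artanh_le_artanh (by linarith) (Real.tanh_lt_one _) hv'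
    rw [Real.artanh_tanh] at h
    linarith
  have hC' : C / s ∈ Set.Ioo (-1 : ℝ) 1 :=
    ⟨by linarith [div_nonneg h0 hs.le], (div_lt_one hs).2 hC⟩
  calc ‖mobSMul s (1 / 2) v‖ ≤ |s * Real.tanh (1 / 2 * Real.artanh (‖v‖ / s))| := by
        rw [mobSMul_eq_smul_normalize]
        exact norm_smul_normalize_le _ v
    _ = s * Real.tanh (1 / 2 * Real.artanh (‖v‖ / s)) :=
        abs_of_nonneg (mul_nonneg hs.le
          (tanh_nonneg (mul_nonneg (by norm_num) (Real.artanh_nonneg hv0))))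
    _ ≤ s * Real.tanh (Real.artanh (C / s)) :=
        mul_le_mul_of_nonneg_left (monotone_tanh hA) hs.le
    _ = C := by rw [Real.tanh_artanh hC', mul_div_cancel₀ _ hs.ne']

theorem measurable_gammaFactor (s : ℝ) : Measurable (gammaFactor s : E d → ℝ) := by
  unfold gammaFactor
  fun_prop

theorem one_le_gammaFactor_sq {y : E d} (hy : ‖y‖ < s) : 1 ≤ gammaFactor s y ^ 2 := by
  rw [gammaFactor_sq hy, one_le_inv₀ (one_sub_sq_div_sq_pos (norm_nonneg y) hy), sub_le_self_iff]
  positivity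

theorem norm_gammaFactor_sq_smul (hs : 0 < s) {y : E d} (hy : ‖y‖ < s) :
    ‖gammaFactor s y ^ 2 • y‖ =
      s * Real.tanh (2 * Real.artanh (‖y‖ / s)) * (gammaFactor s y ^ 2 - 1 / 2) := by
  have hy0 : 0 ≤ ‖y‖ / s := by positivity
  have hpos := one_sub_sq_div_sq_pos (norm_nonneg y) hy
  rw [norm_smul, Real.norm_of_nonneg (sq_nonneg _), gammaFactor_sq hy, tanh_two_mul,
    Real.tanh_artanh ⟨by linarith, (div_lt_one hs).2 hy⟩]
  rw [← div_pow] at hpos ⊢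
  generalize hu : ‖y‖ / s = u at *
  rw [(div_eq_iff hs.ne').1 hu]
  field_simp
  ring

theorem norm_gammaFactor_sq_smul_le (hs : 0 < s) (hC : C < s) {y : E d} (hy : ‖y‖ ≤ C) :
    ‖gammaFactor s y ^ 2 • y‖ ≤
      s * Real.tanh (2 * Real.artanh (C / s)) * (gammaFactor s y ^ 2 - 1 / 2) := by
  have hy0 : 0 ≤ ‖y‖ / s := by positivity
  have hA : Real.artanh (‖y‖ / s) ≤ Real.artanh (C / s) :=
    Real.artanh_le_artanh (by linarith) ((div_lt_one hs).2 hC) (by gcongr)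
  rw [norm_gammaFactor_sq_smul hs (hy.trans_lt hC)]
  refine mul_le_mul_of_nonneg_right
    (mul_le_mul_of_nonneg_left (monotone_tanh (by linarith)) hs.le) ?_
  linarith [one_le_gammaFactor_sq (hy.trans_lt hC)]

/-- The gyrobarycenter of a finite measure `ν` on the ball. The population and the empirical
gyrobarycenter maps evaluate it at conditional laws and at rows of a coupling matrix. -/
def gyroBarycenter (s : ℝ) (ν : Measure (E d)) : E d :=
  mobSMul s (1 / 2)
    ((∫ y, (gammaFactor s y ^ 2 - 1 / 2) ∂ν)⁻¹ • ∫ y, gammaFactor s y ^ 2 • y ∂ν)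

theorem integrable_gammaFactor_sq {ν : Measure (E d)} [IsFiniteMeasure ν] (hC : C < s)
    (hν : ∀ᵐ y ∂ν, ‖y‖ ≤ C) : Integrable (fun y => gammaFactor s y ^ 2) ν := by
  refine Integrable.of_bound
    ((measurable_gammaFactor s).pow_const 2).aestronglyMeasurable
    ((√(1 - C ^ 2 / s ^ 2))⁻¹ ^ 2) ?_
  filter_upwards [hν] with y hy
  rw [Real.norm_of_nonneg (sq_nonneg _)]
  exact pow_le_pow_left₀ (gammaFactor_pos (hy.trans_lt hC)).le (gammaFactor_le hC hy) 2

theorem norm_gyroBarycenter_le {ν : Measure (E d)} [IsFiniteMeasure ν] (h0 : 0 ≤ C)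
    (hC : C < s) (hν : ∀ᵐ y ∂ν, ‖y‖ ≤ C) : ‖gyroBarycenter s ν‖ ≤ C := by
  have hs := h0.trans_lt hC
  refine norm_mobSMul_half_le h0 hC ?_
  have hweight : 0 ≤ ∫ y, (gammaFactor s y ^ 2 - 1 / 2) ∂ν := by
    refine integral_nonneg_of_ae ?_
    filter_upwards [hν] with y hy
    exact sub_nonneg.2 ((by norm_num : (1 / 2 : ℝ) ≤ 1).trans
      (one_le_gammaFactor_sq (hy.trans_lt hC)))
  have hintegral : ‖∫ y, gammaFactor s y ^ 2 • y ∂ν‖ ≤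
      s * Real.tanh (2 * Real.artanh (C / s)) * ∫ y, (gammaFactor s y ^ 2 - 1 / 2) ∂ν := by
    rw [← integral_const_mul]
    refine norm_integral_le_of_norm_le
      (((integrable_gammaFactor_sq hC hν).sub (integrable_const _)).const_mul _) ?_
    filter_upwards [hν] with y hy using norm_gammaFactor_sq_smul_le hs hC hy
  have hradius : 0 ≤ s * Real.tanh (2 * Real.artanh (C / s)) :=
    mul_nonneg hs.le (tanh_nonneg (mul_nonneg zero_le_two (Real.artanh_nonneg (by positivity))))
  rw [norm_smul, norm_inv, Real.norm_of_nonneg hweight, inv_mul_eq_div]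
  exact div_le_of_le_mul₀ hweight hradius hintegral

theorem gyroBary_eq_gyroBarycenter {M : Matrix (Fin n) (Fin m) ℝ} {i : Fin n}
    (hM : ∀ j, 0 ≤ M i j) (Xt : Fin m → E d) :
    gyroBary s M Xt i =
      gyroBarycenter s (∑ j, ENNReal.ofReal (M i j) • Measure.dirac (Xt j)) := by
  have hsum : ∀ {F : Type} [NormedAddCommGroup F] [NormedSpace ℝ F] [CompleteSpace F]
      (f : E d → F),
      ∫ y, f y ∂(∑ j, ENNReal.ofReal (M i j) • Measure.dirac (Xt j)) = ∑ j, M i j • f (Xt j) := by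
    intro F _ _ _ f
    rw [integral_finsetSum_measure fun j _ =>
      (integrable_dirac (by simp)).smul_measure ENNReal.ofReal_ne_top]
    simp [integral_smul_measure, ENNReal.toReal_ofReal (hM _)]
  simp only [gyroBary, gyroBarycenter, hsum, mul_smul, smul_eq_mul]

theorem norm_gyroBary_le (h0 : 0 ≤ C) (hC : C < s) {M : Matrix (Fin n) (Fin m) ℝ} {i : Fin n}
    (hM : ∀ j, 0 ≤ M i j) {Xt : Fin m → E d} (hXt : ∀ j, ‖Xt j‖ ≤ C) :
    ‖gyroBary s M Xt i‖ ≤ C := by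
  have (j : Fin m) : IsFiniteMeasure (ENNReal.ofReal (M i j) • Measure.dirac (Xt j)) :=
    Measure.smul_finite _ ENNReal.ofReal_ne_top
  rw [gyroBary_eq_gyroBarycenter hM]
  refine norm_gyroBarycenter_le h0 hC (ae_finsetSum_measure_iff.2 fun j _ => ?_)
  exact Measure.ae_smul_measure (by simpa [ae_dirac_eq] using hXt j) _

theorem measurable_gyroBaryPop (s : ℝ) (M₀ : Measure (E ds × E dt)) [IsFiniteMeasure M₀] :
    Measurable (gyroBaryPop s M₀) := by
  have hγ : Measurable (gammaFactor s : E dt → ℝ) := measurable_gammaFactor s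
  have hweight : Measurable fun y : E dt => gammaFactor s y ^ 2 - 1 / 2 := by fun_prop
  have hmoment : Measurable fun y : E dt => gammaFactor s y ^ 2 • y := by fun_prop
  have hweight' : Measurable fun x => ∫ y, (gammaFactor s y ^ 2 - 1 / 2) ∂M₀.condKernel x :=
    hweight.stronglyMeasurable.integral_kernel.measurable
  have hmoment' : Measurable fun x => ∫ y, gammaFactor s y ^ 2 • y ∂M₀.condKernel x :=
    hmoment.stronglyMeasurable.integral_kernel.measurable
  exact (measurable_mobSMul s (1 / 2)).comp (hweight'.inv.smul hmoment')

theorem ae_norm_gyroBaryPop_le {M₀ : Measure (E ds × E dt)} [IsFiniteMeasure M₀] (h0 : 0 ≤ C)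
    (hC : C < s) (hM₀ : ∀ᵐ y ∂M₀.snd, ‖y‖ ≤ C) : ∀ᵐ x ∂M₀.fst, ‖gyroBaryPop s M₀ x‖ ≤ C := by
  have h : ∀ᵐ p ∂M₀, ‖p.2‖ ≤ C := ae_of_ae_map measurable_snd.aemeasurable hM₀
  rw [← M₀.disintegrate M₀.condKernel] at h
  filter_upwards [Measure.ae_ae_of_ae_compProd h] with x hx
  exact norm_gyroBarycenter_le h0 hC hx

end Gyrobarycenter

section Deviation

variable {Ω : Type*} [MeasurableSpace Ω] {μ : Measure Ω} {n : ℕ} {X : Fin n → Ω}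

/-- The amount by which the expectation of `g` under `μ` exceeds its empirical mean over the
sample `X`. -/
def deviation (μ : Measure Ω) (X : Fin n → Ω) (g : Ω → ℝ) : ℝ :=
  ∫ x, g x ∂μ - 1 / (n : ℝ) * ∑ i, g (X i)

theorem deviation_sub {g h : Ω → ℝ} (hg : Integrable g μ) (hh : Integrable h μ) :
    deviation μ X (g - h) = deviation μ X g - deviation μ X h := by
  simp only [deviation, Pi.sub_apply, integral_sub hg hh, Finset.sum_sub_distrib]
  ring

theorem deviation_le_two_mul [IsProbabilityMeasure μ] {g : Ω → ℝ} {c : ℝ} (hn : 0 < n)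
    (hg : ∀ᵐ x ∂μ, |g x| ≤ c) (hX : ∀ i, |g (X i)| ≤ c) : deviation μ X g ≤ 2 * c := by
  have hmean : ∫ x, g x ∂μ ≤ c := by
    refine (Real.le_norm_self _).trans ((norm_integral_le_of_norm_le_const hg).trans_eq ?_)
    simp
  have hsum : -(n * c) ≤ ∑ i, g (X i) := by
    have h := Finset.sum_le_sum fun i (_ : i ∈ Finset.univ) => (abs_le.1 (hX i)).1
    simpa using h
  have hn' : (0 : ℝ) < n := Nat.cast_pos.2 hn
  have hemp : -c ≤ 1 / (n : ℝ) * ∑ i, g (X i) := by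
    rw [one_div_mul_eq_div, le_div_iff₀ hn']
    linarith
  unfold deviation
  linarith

theorem deviation_eq_sum_range {g : ℕ → Ω → ℝ} (hg : ∀ k, Integrable (g k) μ) (m : ℕ) :
    deviation μ X (g m) = deviation μ X (g 0) +
      ∑ k ∈ Finset.range m, deviation μ X (g (k + 1) - g k) := by
  simp only [deviation_sub (hg _) (hg _), Finset.sum_range_sub (fun k => deviation μ X (g k))]
  ring

theorem sum_range_succ_mul_half_pow_le (m : ℕ) :
    ∑ k ∈ Finset.range m, ((k : ℝ) + 1) * (1 / 2) ^ k ≤ 4 := by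
  have h : HasSum (fun k : ℕ => ((k : ℝ) + 1) * (1 / 2) ^ k) (1 / (1 - 1 / 2) ^ 2) := by
    simpa only [Nat.choose_one_right, Nat.cast_add_one] using
      hasSum_choose_mul_geometric_of_norm_lt_one 1 (r := (1 / 2 : ℝ)) (by norm_num)
  exact (sum_le_hasSum (Finset.range m) (fun k _ => by positivity) h).trans_eq (by norm_num)

theorem deviation_le_of_chain [IsProbabilityMeasure μ] {g : ℕ → Ω → ℝ} {h : Ω → ℝ} {R e : ℝ}
    (hn : 0 < n) (hR : 0 ≤ R) (hg : ∀ k, Integrable (g k) μ) (hh : Integrable h μ)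
    (h0 : deviation μ X (g 0) ≤ R)
    (hstep : ∀ k : ℕ, deviation μ X (g (k + 1) - g k) ≤ R * ((k + 2) * (1 / 2) ^ (k + 1)))
    (hlim : ∀ m, ∀ᵐ x ∂μ, |h x - g m x| ≤ e * (1 / 2) ^ m)
    (hlimX : ∀ m i, |h (X i) - g m (X i)| ≤ e * (1 / 2) ^ m) :
    deviation μ X h ≤ 4 * R := by
  have hchain : ∀ m, deviation μ X (g m) ≤ 4 * R := fun m => calc
    deviation μ X (g m)
        ≤ R + ∑ k ∈ Finset.range m, R * ((k + 2) * (1 / 2) ^ (k + 1)) := by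
          rw [deviation_eq_sum_range hg]
          exact add_le_add h0 (Finset.sum_le_sum fun k _ => hstep k)
      _ = R * ∑ k ∈ Finset.range (m + 1), ((k : ℝ) + 1) * (1 / 2) ^ k := by
          rw [Finset.sum_range_succ', ← Finset.mul_sum]
          push_cast
          ring_nf
      _ ≤ 4 * R := by
          rw [mul_comm 4]
          exact mul_le_mul_of_nonneg_left (sum_range_succ_mul_half_pow_le _) hR
  have happrox : ∀ m : ℕ, deviation μ X h ≤ 4 * R + 2 * (e * (1 / 2) ^ m) := fun m => by
    have hrest := deviation_le_two_mul (g := h - g m) hn (hlim m) (hlimX m)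
    rw [deviation_sub hh (hg m)] at hrest
    linarith [hchain m]
  have htendsto : Filter.Tendsto (fun m : ℕ => 4 * R + 2 * (e * (1 / 2 : ℝ) ^ m)) Filter.atTop
      (nhds (4 * R + 2 * (e * 0))) :=
    (((tendsto_pow_atTop_nhds_zero_of_lt_one (by norm_num) (by norm_num)).const_mul
      e).const_mul 2).const_add _
  simpa using ge_of_tendsto' htendsto happrox

theorem sum_neg_sub_integral_neg {g : Ω → ℝ} (hn : n ≠ 0) :
    ∑ i, ((-g) (X i) - μ[-g]) = n * deviation μ X g := by
  simp only [deviation, Pi.neg_apply, integral_neg, Finset.sum_sub_distrib, Finset.sum_const,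
    Finset.card_univ, Fintype.card_fin, nsmul_eq_mul, Finset.sum_neg_distrib]
  field_simp
  ring

theorem measure_lt_deviation_le [IsProbabilityMeasure μ] {g : Ω → ℝ} {c u : ℝ} (hn : 0 < n)
    (hm : AEMeasurable g μ) (hb : ∀ᵐ x ∂μ, |g x| ≤ c) (hc : 0 < c) (hu : 0 ≤ u) :
    Measure.pi (fun _ : Fin n => μ) {X | c * √(2 * u / n) < deviation μ X g} ≤
      ENNReal.ofReal (Real.exp (-u)) := by
  have hn' : (0 : ℝ) < n := Nat.cast_pos.2 hn
  have hsub : HasSubgaussianMGF (fun x => (-g) x - μ[-g]) ((‖c - -c‖₊ / 2) ^ 2) μ := by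
    refine hasSubgaussianMGF_of_mem_Icc hm.neg ?_
    filter_upwards [hb] with x hx
    exact ⟨neg_le_neg (abs_le.1 hx).2, neg_le.1 (abs_le.1 hx).1⟩
  have hindep : iIndepFun (fun (i : Fin n) (X : Fin n → Ω) => (-g) (X i) - μ[-g])
      (Measure.pi fun _ : Fin n => μ) :=
    iIndepFun_pi (X := fun _ x => (-g) x - μ[-g]) fun _ => hm.neg.sub_const _
  have hsub_eval : ∀ i ∈ (Finset.univ : Finset (Fin n)),
      HasSubgaussianMGF (fun X : Fin n → Ω => (-g) (X i) - μ[-g]) ((‖c - -c‖₊ / 2) ^ 2)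
        (Measure.pi fun _ : Fin n => μ) := fun i _ => by
    refine HasSubgaussianMGF.of_map (Y := fun X : Fin n → Ω => X i)
      (X := fun x => (-g) x - μ[-g]) (measurable_pi_apply i).aemeasurable ?_
    rwa [(measurePreserving_eval (fun _ : Fin n => μ) i).map_eq]
  have htail := HasSubgaussianMGF.measure_sum_ge_le_of_iIndepFun hindep hsub_eval
    (ε := n * (c * √(2 * u / n))) (by positivity)
  have hexp : -(n * (c * √(2 * u / n))) ^ 2 /
      (2 * ∑ _i : Fin n, (((‖c - -c‖₊ / 2) ^ 2 : NNReal) : ℝ)) = -u := by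
    have hcc : ‖c - -c‖ / 2 = c := by
      rw [Real.norm_of_nonneg (by linarith)]
      ring
    simp only [NNReal.coe_pow, NNReal.coe_div, coe_nnnorm, NNReal.coe_ofNat, hcc, mul_pow,
      Real.sq_sqrt (show 0 ≤ 2 * u / n by positivity), Finset.sum_const, Finset.card_univ,
      Fintype.card_fin, nsmul_eq_mul]
    field_simp
  push_cast at htail hexp
  rw [hexp] at htail
  rw [← ofReal_measureReal]
  refine ENNReal.ofReal_le_ofReal ((measureReal_mono fun X hX => ?_).trans htail)
  have hX' := mul_le_mul_of_nonneg_left (Set.mem_ofPred_eq ▸ hX).le hn'.le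
  exact hX'.trans_eq (sum_neg_sub_integral_neg hn.ne').symm

theorem measure_exists_mem_lt_deviation_le [IsProbabilityMeasure μ] {F : Finset (Ω → ℝ)}
    {c u : ℝ} (hn : 0 < n) (hm : ∀ g ∈ F, AEMeasurable g μ) (hb : ∀ g ∈ F, ∀ᵐ x ∂μ, |g x| ≤ c)
    (hc : 0 < c) (hu : 0 ≤ u) :
    Measure.pi (fun _ : Fin n => μ) {X | ∃ g ∈ F, c * √(2 * u / n) < deviation μ X g} ≤
      ENNReal.ofReal (F.card * Real.exp (-u)) := by
  set P := Measure.pi fun _ : Fin n => μ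
  calc P {X | ∃ g ∈ F, c * √(2 * u / n) < deviation μ X g}
      = P (⋃ g ∈ F, {X | c * √(2 * u / n) < deviation μ X g}) := by
        congr 1
        ext X
        simp
    _ ≤ ∑ g ∈ F, P {X | c * √(2 * u / n) < deviation μ X g} := measure_biUnion_finset_le _ _
    _ ≤ ∑ _g ∈ F, ENNReal.ofReal (Real.exp (-u)) :=
        Finset.sum_le_sum fun g hg => measure_lt_deviation_le hn (hm g hg) (hb g hg) hc hu
    _ = ENNReal.ofReal (F.card * Real.exp (-u)) := by
        rw [Finset.sum_const, nsmul_eq_mul, ENNReal.ofReal_mul (Nat.cast_nonneg _),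
          ENNReal.ofReal_natCast]

theorem tsum_ofReal_mul_half_pow_succ {δ : ℝ} (h0 : 0 ≤ δ) :
    ∑' k : ℕ, ENNReal.ofReal (δ * (1 / 2) ^ (k + 1)) = ENNReal.ofReal δ := by
  have hsum : HasSum (fun k : ℕ => δ * (1 / 2 : ℝ) ^ (k + 1)) δ :=
    (hasSum_geometric_two' δ).congr_fun fun k => by
      rw [one_div, inv_pow]
      field_simp
      ring
  rw [← ENNReal.ofReal_tsum_of_nonneg (fun k => by positivity) hsum.summable, hsum.tsum_eq]

theorem measure_exists_lt_deviation_le [IsProbabilityMeasure μ] {F : ℕ → Finset (Ω → ℝ)}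
    {B c δ : ℝ} (hn : 0 < n) (hB : 1 ≤ B) (hc : 0 < c) (h0 : 0 < δ) (h1 : δ < 1)
    (hcard : ∀ k, ((F k).card : ℝ) ≤ B ^ (k + 1)) (hm : ∀ k, ∀ g ∈ F k, AEMeasurable g μ)
    (hb : ∀ k, ∀ g ∈ F k, ∀ᵐ x ∂μ, |g x| ≤ c * (1 / 2) ^ k) :
    Measure.pi (fun _ : Fin n => μ) {X | ∃ k : ℕ, ∃ g ∈ F k, c * (1 / 2) ^ k *
        √(2 * (Real.log (1 / δ) + (k + 1) * Real.log (2 * B)) / n) < deviation μ X g} ≤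
      ENNReal.ofReal δ := by
  set P := Measure.pi fun _ : Fin n => μ
  set u : ℕ → ℝ := fun k => Real.log (1 / δ) + (k + 1) * Real.log (2 * B)
  have hu : ∀ k, 0 ≤ u k := fun k =>
    add_nonneg (Real.log_nonneg ((one_le_div h0).2 h1.le))
      (mul_nonneg (by positivity) (Real.log_nonneg (by linarith)))
  have hexp : ∀ k, Real.exp (-u k) = δ / (2 * B) ^ (k + 1) := fun k => by
    rw [neg_add, Real.exp_add, ← Real.log_inv, one_div, inv_inv, Real.exp_log h0, Real.exp_neg,
      ← Nat.cast_add_one, Real.exp_nat_mul, Real.exp_log (by linarith), div_eq_mul_inv]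
  have hlevel : ∀ k, P {X | ∃ g ∈ F k, c * (1 / 2) ^ k * √(2 * u k / n) < deviation μ X g} ≤
      ENNReal.ofReal (δ * (1 / 2) ^ (k + 1)) := fun k => calc
    _ ≤ ENNReal.ofReal ((F k).card * (δ / (2 * B) ^ (k + 1))) :=
        hexp k ▸ measure_exists_mem_lt_deviation_le hn (hm k) (hb k) (by positivity) (hu k)
    _ ≤ ENNReal.ofReal (B ^ (k + 1) * (δ / (2 * B) ^ (k + 1))) := by
        gcongr
        exact hcard k
    _ = ENNReal.ofReal (δ * (1 / 2) ^ (k + 1)) := by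
        congr 1
        rw [mul_pow, one_div, inv_pow]
        field_simp
  calc _ = P (⋃ k, {X | ∃ g ∈ F k, c * (1 / 2) ^ k * √(2 * u k / n) < deviation μ X g}) := by
        rw [← Set.ofPred_exists]
    _ ≤ ∑' k : ℕ, ENNReal.ofReal (δ * (1 / 2) ^ (k + 1)) :=
        (measure_iUnion_le _).trans (ENNReal.tsum_le_tsum hlevel)
    _ = ENNReal.ofReal δ := tsum_ofReal_mul_half_pow_succ h0.le

end Deviation

section Chaining

variable {Θ Ω : Type*} [PseudoMetricSpace Θ] {S : Set Θ} {N : ℕ → Finset Θ}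
  {f : Θ → Ω → ℝ} {A D Λ : ℝ} {M : ℕ}

/-- A sequence of finite nets of `S`, of precision `D / 2 ^ k` and size at most `M ^ k` at
level `k`: the entropy condition under which chaining produces no logarithmic loss. -/
structure IsGeometricNet (S : Set Θ) (D : ℝ) (M : ℕ) (N : ℕ → Finset Θ) : Prop where
  subset : ∀ k, ∀ p ∈ N k, p ∈ S
  one_le : 1 ≤ M
  card_le : ∀ k, (N k).card ≤ M ^ k
  exists_dist_le : ∀ k, ∀ θ ∈ S, ∃ p ∈ N k, dist θ p ≤ D * (1 / 2) ^ k

open Classical in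
/-- The functions that occur in a chain along the nets `N`: at level `0` the members of the class
`f` over `N 0`, at level `k + 1` the increments of `f` from a point of `N k` to a point of
`N (k + 1)` at distance at most `D / 2 ^ k + D / 2 ^ (k + 1)`. -/
def chainLinks (f : Θ → Ω → ℝ) (D : ℝ) (N : ℕ → Finset Θ) : ℕ → Finset (Ω → ℝ)
  | 0 => (N 0).image f
  | k + 1 => {p ∈ N k ×ˢ N (k + 1) | dist p.2 p.1 ≤ 3 * D * (1 / 2) ^ (k + 1)}.image
      fun p => f p.2 - f p.1

theorem IsGeometricNet.card_chainLinks_le (hN : IsGeometricNet S D M N) (k : ℕ) :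
    ((chainLinks f D N k).card : ℝ) ≤ ((M : ℝ) ^ 2) ^ (k + 1) := by
  classical
  suffices h : (chainLinks f D N k).card ≤ M ^ (2 * (k + 1)) by
    rw [← pow_mul]
    exact_mod_cast h
  cases k with
  | zero =>
    exact Finset.card_image_le.trans ((hN.card_le 0).trans (Nat.pow_le_pow_right hN.one_le
      (Nat.zero_le _)))
  | succ k =>
    calc (chainLinks f D N (k + 1)).card
        ≤ (N k ×ˢ N (k + 1)).card :=
          Finset.card_image_le.trans (Finset.card_le_card (Finset.filter_subset _ _))
      _ ≤ M ^ k * M ^ (k + 1) := by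
          rw [Finset.card_product]
          exact Nat.mul_le_mul (hN.card_le k) (hN.card_le (k + 1))
      _ ≤ M ^ (2 * (k + 1 + 1)) := by
          rw [← pow_add]
          exact Nat.pow_le_pow_right hN.one_le (by lia)

theorem IsGeometricNet.abs_chainLinks_le (hN : IsGeometricNet S D M N) (hA0 : 0 ≤ A)
    (hD : 0 ≤ D) (hΛ0 : 0 ≤ Λ) {x : Ω} (hA : ∀ θ ∈ S, |f θ x| ≤ A)
    (hΛ : ∀ θ ∈ S, ∀ θ' ∈ S, |f θ x - f θ' x| ≤ Λ * dist θ θ') {k : ℕ} {g : Ω → ℝ}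
    (hg : g ∈ chainLinks f D N k) : |g x| ≤ (A + 3 * D * Λ) * (1 / 2) ^ k := by
  classical
  cases k with
  | zero =>
    obtain ⟨p, hp, rfl⟩ := Finset.mem_image.1 hg
    rw [pow_zero, mul_one]
    exact (hA p (hN.subset 0 p hp)).trans (le_add_of_nonneg_right (by positivity))
  | succ k =>
    obtain ⟨⟨p, q⟩, hpq, rfl⟩ := Finset.mem_image.1 hg
    obtain ⟨hmem, hdist⟩ := Finset.mem_filter.1 hpq
    obtain ⟨hp, hq⟩ := Finset.mem_product.1 hmem
    calc |f q x - f p x| ≤ Λ * dist q p := hΛ q (hN.subset _ q hq) p (hN.subset _ p hp)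
      _ ≤ Λ * (3 * D * (1 / 2) ^ (k + 1)) := mul_le_mul_of_nonneg_left hdist hΛ0
      _ = 3 * D * Λ * (1 / 2) ^ (k + 1) := by ring
      _ ≤ (A + 3 * D * Λ) * (1 / 2) ^ (k + 1) := by
          gcongr
          exact le_add_of_nonneg_left hA0

theorem IsGeometricNet.exists_chain (hN : IsGeometricNet S D M N) {θ : Θ} (hθ : θ ∈ S) :
    ∃ π : ℕ → Θ, (∀ k, π k ∈ S) ∧ (∀ k, dist θ (π k) ≤ D * (1 / 2) ^ k) ∧
      f (π 0) ∈ chainLinks f D N 0 ∧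
      ∀ k, f (π (k + 1)) - f (π k) ∈ chainLinks f D N (k + 1) := by
  classical
  choose π hπN hπ using fun k => hN.exists_dist_le k θ hθ
  refine ⟨π, fun k => hN.subset k _ (hπN k), hπ, Finset.mem_image_of_mem _ (hπN 0),
    fun k => Finset.mem_image.2 ⟨(π k, π (k + 1)), ?_, rfl⟩⟩
  refine Finset.mem_filter.2 ⟨Finset.mem_product.2 ⟨hπN k, hπN (k + 1)⟩, ?_⟩
  calc dist (π (k + 1)) (π k) ≤ dist θ (π (k + 1)) + dist θ (π k) := dist_triangle_left _ _ _
    _ ≤ D * (1 / 2) ^ (k + 1) + D * (1 / 2) ^ k := add_le_add (hπ (k + 1)) (hπ k)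
    _ = 3 * D * (1 / 2) ^ (k + 1) := by ring

theorem sqrt_two_mul_add_mul_div_le {l β : ℝ} (hl : 0 ≤ l) (hβ : 0 ≤ β) (k n : ℕ) :
    √(2 * (l + (k + 1) * β) / n) ≤ √2 * (1 + √β) * (1 + √l) / √n * (k + 1) := by
  have hk : (1 : ℝ) ≤ k + 1 := by simp
  have hroot : √(l + (k + 1) * β) ≤ (1 + √β) * (1 + √l) * (k + 1) := by
    refine Real.sqrt_le_iff.2 ⟨by positivity, ?_⟩
    calc l + (k + 1) * β ≤ (β + l) * (k + 1) ^ 2 := by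
          nlinarith [mul_nonneg hl (sub_nonneg.2 (one_le_pow₀ hk (n := 2))),
            mul_nonneg (mul_nonneg hβ (zero_le_one.trans hk)) (sub_nonneg.2 hk)]
      _ ≤ ((1 + √β) ^ 2 * (1 + √l) ^ 2) * (k + 1) ^ 2 := by
          gcongr
          nlinarith [Real.sq_sqrt hl, Real.sq_sqrt hβ, Real.sqrt_nonneg l, Real.sqrt_nonneg β,
            mul_nonneg (sq_nonneg √β) (Real.sqrt_nonneg l), mul_nonneg (sq_nonneg √l)
            (Real.sqrt_nonneg β), mul_nonneg (Real.sqrt_nonneg β) (Real.sqrt_nonneg l),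
            mul_nonneg hl hβ]
      _ = ((1 + √β) * (1 + √l) * (k + 1)) ^ 2 := by ring
  rw [Real.sqrt_div (by positivity), Real.sqrt_mul zero_le_two, div_mul_eq_mul_div]
  refine div_le_div_of_nonneg_right ?_ (Real.sqrt_nonneg _)
  calc √2 * √(l + (k + 1) * β) ≤ √2 * ((1 + √β) * (1 + √l) * (k + 1)) := by
        gcongr
    _ = √2 * (1 + √β) * (1 + √l) * (k + 1) := by ring

/-- The constant of the uniform deviation bound for a class of functions whose chain links at
level `k` are bounded by `c / 2 ^ k` and form a family of size at most `M ^ (2 * (k + 1))`. -/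
def chainConst (M : ℕ) (c : ℝ) : ℝ := 4 * (c * (√2 * (1 + √(Real.log (2 * M ^ 2)))))

variable [MeasurableSpace Ω] {μ : Measure Ω}

theorem IsGeometricNet.aemeasurable_chainLinks (hN : IsGeometricNet S D M N)
    (hm : ∀ θ ∈ S, AEMeasurable (f θ) μ) {k : ℕ} {g : Ω → ℝ} (hg : g ∈ chainLinks f D N k) :
    AEMeasurable g μ := by
  classical
  cases k with
  | zero =>
    obtain ⟨p, hp, rfl⟩ := Finset.mem_image.1 hg
    exact hm p (hN.subset 0 p hp)
  | succ k =>
    obtain ⟨⟨p, q⟩, hpq, rfl⟩ := Finset.mem_image.1 hg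
    obtain ⟨hp, hq⟩ := Finset.mem_product.1 (Finset.mem_filter.1 hpq).1
    exact (hm q (hN.subset _ q hq)).sub (hm p (hN.subset _ p hp))

theorem deviation_le_of_chainLinks [IsProbabilityMeasure μ] {n : ℕ} {X : Fin n → Ω} {R : ℝ}
    (hn : 0 < n) (hN : IsGeometricNet S D M N) (hΛ0 : 0 ≤ Λ) (hR : 0 ≤ R)
    (hf : ∀ θ ∈ S, Integrable (f θ) μ)
    (hΛ : ∀ᵐ x ∂μ, ∀ θ ∈ S, ∀ θ' ∈ S, |f θ x - f θ' x| ≤ Λ * dist θ θ')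
    (hΛX : ∀ i, ∀ θ ∈ S, ∀ θ' ∈ S, |f θ (X i) - f θ' (X i)| ≤ Λ * dist θ θ')
    (hlinks : ∀ k, ∀ g ∈ chainLinks f D N k, deviation μ X g ≤ R * ((k + 1) * (1 / 2) ^ k))
    {θ : Θ} (hθ : θ ∈ S) : deviation μ X (f θ) ≤ 4 * R := by
  obtain ⟨π, hπ, hdist, hzero, hstep⟩ := hN.exists_chain (f := f) hθ
  have hclose : ∀ m, Λ * dist θ (π m) ≤ Λ * D * (1 / 2) ^ m := fun m => by
    rw [mul_assoc]
    exact mul_le_mul_of_nonneg_left (hdist m) hΛ0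
  refine deviation_le_of_chain (g := fun k => f (π k)) (e := Λ * D) hn hR (fun k => hf _ (hπ k))
    (hf θ hθ) (by simpa using hlinks 0 _ hzero) (fun k => ?_) (fun m => ?_)
    fun m i => (hΛX i θ hθ _ (hπ m)).trans (hclose m)
  · refine (hlinks (k + 1) _ (hstep k)).trans_eq ?_
    push_cast
    ring
  · filter_upwards [hΛ] with x hx using (hx θ hθ _ (hπ m)).trans (hclose m)

theorem measure_not_forall_deviation_le [IsProbabilityMeasure μ] {n : ℕ} {δ : ℝ} (hn : 0 < n)
    (h0 : 0 < δ) (h1 : δ < 1) (hN : IsGeometricNet S D M N) (hA0 : 0 < A) (hD : 0 ≤ D)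
    (hΛ0 : 0 ≤ Λ) (hm : ∀ θ ∈ S, AEMeasurable (f θ) μ) (hA : ∀ᵐ x ∂μ, ∀ θ ∈ S, |f θ x| ≤ A)
    (hΛ : ∀ᵐ x ∂μ, ∀ θ ∈ S, ∀ θ' ∈ S, |f θ x - f θ' x| ≤ Λ * dist θ θ') :
    Measure.pi (fun _ : Fin n => μ) {X | ¬ ∀ θ ∈ S, deviation μ X (f θ) ≤
        chainConst M (A + 3 * D * Λ) * (1 + √(Real.log (1 / δ))) / √(n : ℝ)} ≤
      ENNReal.ofReal δ := by
  have hB : (1 : ℝ) ≤ (M : ℝ) ^ 2 := one_le_pow₀ (by exact_mod_cast hN.one_le)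
  have hc : 0 < A + 3 * D * Λ := by positivity
  have hΛX : ∀ᵐ X ∂Measure.pi fun _ : Fin n => μ, ∀ i, ∀ θ ∈ S, ∀ θ' ∈ S,
      |f θ (X i) - f θ' (X i)| ≤ Λ * dist θ θ' :=
    ae_all_iff.2 fun i => (Measure.quasiMeasurePreserving_eval (fun _ : Fin n => μ) i).ae hΛ
  refine (measure_mono_ae ?_).trans (measure_exists_lt_deviation_le hn hB hc h0 h1
    (F := chainLinks f D N) hN.card_chainLinks_le (fun k g hg => hN.aemeasurable_chainLinks hm hg)
    fun k g hg => ?_)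
  · filter_upwards [hΛX] with X hX
    refine not_imp_comm.1 fun hX' θ hθ => ?_
    have hf : ∀ θ ∈ S, Integrable (f θ) μ := fun θ hθ =>
      Integrable.of_bound (hm θ hθ).aestronglyMeasurable A (hA.mono fun x hx => hx θ hθ)
    refine (deviation_le_of_chainLinks hn hN hΛ0 (R := (A + 3 * D * Λ) *
      (√2 * (1 + √(Real.log (2 * M ^ 2))) * (1 + √(Real.log (1 / δ))) / √n)) (by positivity) hf
      hΛ hX (fun k g hg => (not_lt.1 fun hlt => hX' ⟨k, g, hg, hlt⟩).trans ?_) hθ).trans_eq ?_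
    · refine (mul_le_mul_of_nonneg_left (sqrt_two_mul_add_mul_div_le
        (Real.log_nonneg ((one_le_div h0).2 h1.le)) (Real.log_nonneg (by linarith)) k n)
        (by positivity)).trans_eq ?_
      ring
    · rw [chainConst]
      ring
  · filter_upwards [hA, hΛ] with x hAx hΛx
    exact hN.abs_chainLinks_le hA0.le hD hΛ0 hAx hΛx hg

end Chaining

section Net

variable {V : Type*} [NormedAddCommGroup V] [NormedSpace ℝ V]

variable (V) in
theorem exists_finset_unitBall_cover [FiniteDimensional ℝ V] :
    ∃ t : Finset V, ∀ v : V, ‖v‖ ≤ 1 → ∃ p ∈ t, ‖v - p‖ ≤ 1 / 2 := by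
  obtain ⟨t, -, ht, hcover⟩ := Metric.exists_finite_isCover_of_isCompact (ε := 1 / 2)
    (by norm_num) (isCompact_closedBall (0 : V) 1)
  rw [Metric.isCover_iff_subset_iUnion_closedBall] at hcover
  refine ⟨ht.toFinset, fun v hv => ?_⟩
  obtain ⟨p, hp, hvp⟩ := Set.mem_iUnion₂.1 (hcover (mem_closedBall_zero_iff.2 hv))
  exact ⟨p, ht.mem_toFinset.2 hp, by simpa [dist_eq_norm] using hvp⟩

theorem exists_finset_closedBall_cover {t : Finset V}
    (ht : ∀ v : V, ‖v‖ ≤ 1 → ∃ p ∈ t, ‖v - p‖ ≤ 1 / 2) {r : ℝ} (hr : 0 < r) (c : V) (k : ℕ) :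
    ∃ N : Finset V, N.card ≤ t.card ^ k ∧
      ∀ v ∈ Metric.closedBall c r, ∃ p ∈ N, dist v p ≤ r * (1 / 2) ^ k := by
  classical
  induction k with
  | zero => exact ⟨{c}, by simp, fun v hv => ⟨c, by simp, by simpa using hv⟩⟩
  | succ k ih =>
    obtain ⟨N, hcard, hN⟩ := ih
    set e := r * (1 / 2) ^ k
    have he0 : 0 < e := by positivity
    refine ⟨Finset.image₂ (fun p q => p + e • q) N t, ?_, fun v hv => ?_⟩
    · rw [pow_succ]
      exact (Finset.card_image₂_le _ _ _).trans (Nat.mul_le_mul_right _ hcard)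
    · obtain ⟨p, hp, hvp⟩ := hN v hv
      obtain ⟨q, hq, hvq⟩ := ht (e⁻¹ • (v - p)) (by
        rwa [norm_smul, norm_inv, Real.norm_of_nonneg he0.le, inv_mul_le_one₀ he0, ← dist_eq_norm])
      refine ⟨p + e • q, Finset.mem_image₂_of_mem hp hq, ?_⟩
      have hsplit : v - (p + e • q) = e • (e⁻¹ • (v - p) - q) := by
        rw [smul_sub, smul_inv_smul₀ he0.ne', sub_sub]
      rw [dist_eq_norm, hsplit, norm_smul, Real.norm_of_nonneg he0.le, pow_succ, ← mul_assoc]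
      exact mul_le_mul_of_nonneg_left hvq he0.le

theorem exists_finset_internal_cover {Θ : Type*} [PseudoMetricSpace Θ] {S : Set Θ}
    (N : Finset Θ) {e : ℝ} (hN : ∀ θ ∈ S, ∃ p ∈ N, dist θ p ≤ e) :
    ∃ N' : Finset Θ, (∀ p ∈ N', p ∈ S) ∧ N'.card ≤ N.card ∧
      ∀ θ ∈ S, ∃ p ∈ N', dist θ p ≤ 2 * e := by
  classical
  choose! g hg hdist using fun p (hp : ∃ θ ∈ S, dist θ p ≤ e) => hp
  refine ⟨{p ∈ N | ∃ θ ∈ S, dist θ p ≤ e}.image g, ?_,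
    Finset.card_image_le.trans (Finset.card_le_card (Finset.filter_subset _ _)), fun θ hθ => ?_⟩
  · simp only [Finset.forall_mem_image, Finset.mem_filter]
    exact fun p hp => hg p hp.2
  · obtain ⟨p, hp, hθp⟩ := hN θ hθ
    refine ⟨g p, Finset.mem_image_of_mem _ (Finset.mem_filter.2 ⟨hp, θ, hθ, hθp⟩), ?_⟩
    calc dist θ (g p) ≤ dist θ p + dist (g p) p := dist_triangle_right _ _ _
      _ ≤ 2 * e := by linarith [hdist p ⟨θ, hθ, hθp⟩]

theorem exists_isGeometricNet_closedBall [FiniteDimensional ℝ V] (c : V) {r : ℝ} (hr : 0 < r) :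
    ∃ M N, IsGeometricNet (Metric.closedBall c r) (2 * r) M N := by
  obtain ⟨t, ht⟩ := exists_finset_unitBall_cover V
  choose N hcard hN using exists_finset_closedBall_cover ht hr c
  choose N' hsub hcard' hN' using fun k => exists_finset_internal_cover (N k) (hN k)
  obtain ⟨p, hp, -⟩ := ht 0 (by simp)
  exact ⟨t.card, N', hsub, Finset.card_pos.2 ⟨p, hp⟩, fun k => (hcard' k).trans (hcard k),
    fun k θ hθ => by simpa only [mul_assoc] using hN' k θ hθ⟩

end Net

section Quality

open scoped Matrix.Norms.Frobenius

section Transport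

variable {d n : ℕ} {s ρ e : ℝ} {Ω : Type*} [MeasurableSpace Ω] {μ : Measure Ω}
  [IsFiniteMeasure μ] {T T' B : Ω → E d}

theorem integral_pdist_le_add (hs : 0 < s) (hρ : ρ < s) (hT : AEMeasurable T μ)
    (hT' : AEMeasurable T' μ) (hB : AEMeasurable B μ) (hTρ : ∀ᵐ x ∂μ, ‖T x‖ ≤ ρ)
    (hTρ' : ∀ᵐ x ∂μ, ‖T' x‖ ≤ ρ) (hBρ : ∀ᵐ x ∂μ, ‖B x‖ ≤ ρ) :
    ∫ x, pdist s (T x) (T' x) ∂μ ≤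
      ∫ x, pdist s (T x) (B x) ∂μ + ∫ x, pdist s (T' x) (B x) ∂μ := by
  have hTB := integrable_pdist hs hρ hT hB hTρ hBρ
  have hTB' := integrable_pdist hs hρ hT' hB hTρ' hBρ
  rw [← integral_add hTB hTB']
  refine integral_mono_ae (integrable_pdist hs hρ hT hT' hTρ hTρ') (hTB.add hTB') ?_
  filter_upwards [hTρ, hTρ', hBρ] with x hx hx' hBx
  rw [pdist_comm hs (hx'.trans_lt hρ) (hBx.trans_lt hρ)]
  exact pdist_triangle hs (hx.trans_lt hρ) (hBx.trans_lt hρ) (hx'.trans_lt hρ)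

theorem average_pdist_le_add (hs : 0 < s) (hρ : ρ < s) {u v w : Fin n → E d}
    (hu : ∀ i, ‖u i‖ ≤ ρ) (hv : ∀ i, ‖v i‖ ≤ ρ) (hw : ∀ i, ‖w i‖ ≤ ρ) :
    1 / (n : ℝ) * ∑ i, pdist s (u i) (w i) ≤
      1 / (n : ℝ) * ∑ i, pdist s (u i) (v i) + 1 / (n : ℝ) * ∑ i, pdist s (v i) (w i) := by
  rw [← mul_add, ← Finset.sum_add_distrib]
  refine mul_le_mul_of_nonneg_left (Finset.sum_le_sum fun i _ => ?_) (by positivity)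
  exact pdist_triangle hs ((hu i).trans_lt hρ) ((hv i).trans_lt hρ) ((hw i).trans_lt hρ)

theorem integral_pdist_le_of_deviation_le (hs : 0 < s) (hρ : ρ < s) (hT : AEMeasurable T μ)
    (hT' : AEMeasurable T' μ) (hB : AEMeasurable B μ) (hTρ : ∀ᵐ x ∂μ, ‖T x‖ ≤ ρ)
    (hTρ' : ∀ᵐ x ∂μ, ‖T' x‖ ≤ ρ) (hBρ : ∀ᵐ x ∂μ, ‖B x‖ ≤ ρ) {X : Fin n → Ω}
    {y : Fin n → E d} (hTX : ∀ i, ‖T (X i)‖ ≤ ρ) (hBX : ∀ i, ‖B (X i)‖ ≤ ρ)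
    (hy : ∀ i, ‖y i‖ ≤ ρ) (hdev : deviation μ X (fun x => pdist s (T x) (B x)) ≤ e) :
    ∫ x, pdist s (T x) (T' x) ∂μ ≤
      1 / (n : ℝ) * ∑ i, pdist s (T (X i)) (y i) + 1 / (n : ℝ) * ∑ i, pdist s (y i) (B (X i))
        + ∫ x, pdist s (T' x) (B x) ∂μ + e := by
  have hpop := integral_pdist_le_add hs hρ hT hT' hB hTρ hTρ' hBρ
  have hemp := average_pdist_le_add hs hρ hTX hy hBX
  rw [deviation] at hdev
  linarith

end Transport

section Learned

variable {ds dt n m : ℕ} {s ω Cx Cy R : ℝ} {K L : Matrix (Fin dt) (Fin ds) ℝ}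

/-- A common bound for the points of norm at most `Cy` and for the images of the points of norm at
most `Cx` under the layers of matrices of Frobenius norm at most `F`. -/
def imageRadius (s Cx Cy F : ℝ) : ℝ := max Cy (s * Real.tanh (F * Real.artanh (Cx / s)))

theorem le_imageRadius (s Cx Cy F : ℝ) : Cy ≤ imageRadius s Cx Cy F :=
  le_max_left _ _

theorem imageRadius_lt (hs : 0 < s) (hCy : Cy < s) (F : ℝ) : imageRadius s Cx Cy F < s :=
  max_lt hCy (mul_lt_of_lt_one_right hs (Real.tanh_lt_one _))

theorem norm_mobLayer_le_imageRadius (hs : 0 < s) (hCx : Cx < s) (hL : L ∈ Metric.closedBall K R)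
    {x : E ds} (hx : ‖x‖ ≤ Cx) : ‖mobLayer s L x‖ ≤ imageRadius s Cx Cy (‖K‖ + R) :=
  (norm_mobLayer_le hs hCx (norm_le_of_mem_closedBall hL) hx).trans (le_max_right _ _)

/-- A bound for the Frobenius distance from `K` to the matrices whose quality loss is at most that
of `K`: the loss of `K` consists of the fitting term only. The summand `1` makes it positive. -/
def learnedRadius (s ω Cx Cy : ℝ) (K : Matrix (Fin dt) (Fin ds) ℝ) : ℝ :=
  √(pdistLip s (imageRadius s Cx Cy ‖K‖) * (2 * imageRadius s Cx Cy ‖K‖) / ω) + 1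

theorem learnedRadius_pos (s ω Cx Cy : ℝ) (K : Matrix (Fin dt) (Fin ds) ℝ) :
    0 < learnedRadius s ω Cx Cy K := by
  unfold learnedRadius
  positivity

theorem mul_norm_sub_sq_le_qualityLoss (hs : 0 ≤ s) (X : Fin n → E ds) (Xt : Fin m → E dt)
    (M : Matrix (Fin n) (Fin m) ℝ) : ω * ‖L - K‖ ^ 2 ≤ qualityLoss s ω K X Xt M L := by
  rw [frobenius_norm_sq]
  exact le_add_of_nonneg_left
    (mul_nonneg (by positivity) (Finset.sum_nonneg fun i _ => pdist_nonneg hs _ _))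

theorem qualityLoss_self_le (hn : 0 < n) (h0 : 0 ≤ Cy) (hCx : Cx < s) (hCy : Cy < s)
    {X : Fin n → E ds} {Xt : Fin m → E dt} {M : Matrix (Fin n) (Fin m) ℝ}
    (hX : ∀ i, ‖X i‖ ≤ Cx) (hXt : ∀ j, ‖Xt j‖ ≤ Cy) (hM : ∀ i j, 0 ≤ M i j) :
    qualityLoss s ω K X Xt M K ≤
      pdistLip s (imageRadius s Cx Cy ‖K‖) * (2 * imageRadius s Cx Cy ‖K‖) := by
  have hs := h0.trans_lt hCy
  have hn' : (0 : ℝ) < n := Nat.cast_pos.2 hn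
  have hpdist (i : Fin n) : pdist s (gyroBary s M Xt i) (mobLayer s K (X i)) ≤
      pdistLip s (imageRadius s Cx Cy ‖K‖) * (2 * imageRadius s Cx Cy ‖K‖) :=
    pdist_le_pdistLip_mul_two_mul hs (imageRadius_lt hs hCy _)
      ((norm_gyroBary_le h0 hCy (hM i) hXt).trans (le_imageRadius ..))
      ((norm_mobLayer_le hs hCx le_rfl (hX i)).trans (le_max_right _ _))
  have hsum := Finset.sum_le_card_nsmul Finset.univ _ _ fun i _ => hpdist i
  rw [Finset.card_univ, Fintype.card_fin, nsmul_eq_mul] at hsum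
  simpa only [qualityLoss, sub_self, zero_pow two_ne_zero, Finset.sum_const_zero, mul_zero,
    add_zero, one_div, inv_mul_le_iff₀ hn'] using hsum

theorem mem_closedBall_of_qualityLoss_le (hω : 0 < ω) (hn : 0 < n) (h0 : 0 ≤ Cy) (hCx : Cx < s)
    (hCy : Cy < s) {X : Fin n → E ds} {Xt : Fin m → E dt} {M : Matrix (Fin n) (Fin m) ℝ}
    (hX : ∀ i, ‖X i‖ ≤ Cx) (hXt : ∀ j, ‖Xt j‖ ≤ Cy) (hM : ∀ i j, 0 ≤ M i j)
    (hL : qualityLoss s ω K X Xt M L ≤ qualityLoss s ω K X Xt M K) :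
    L ∈ Metric.closedBall K (learnedRadius s ω Cx Cy K) := by
  have h := (mul_norm_sub_sq_le_qualityLoss (h0.trans hCy.le) X Xt M).trans
    (hL.trans (qualityLoss_self_le hn h0 hCx hCy hX hXt hM))
  rw [mem_closedBall_iff_norm]
  exact (Real.le_sqrt_of_sq_le ((le_div_iff₀' hω).2 h)).trans (lt_add_one _).le

end Learned

section Event

variable {ds dt : ℕ} {s Cx Cy R : ℝ}

theorem exists_measurableSet_of_measure_not_le {Ω : Type*} [MeasurableSpace Ω] {P : Measure Ω}
    [IsProbabilityMeasure P] {p q : Ω → Prop} {δ : ℝ} (h0 : 0 ≤ δ) (hp : ∀ᵐ ω ∂P, p ω)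
    (hq : P {ω | ¬ q ω} ≤ ENNReal.ofReal δ) :
    ∃ G, MeasurableSet G ∧ ENNReal.ofReal (1 - δ) ≤ P G ∧ ∀ ω ∈ G, p ω ∧ q ω := by
  have hbad : P {ω | ¬ (p ω ∧ q ω)} ≤ ENNReal.ofReal δ :=
    (measure_mono_ae (hp.mono fun ω hω h h' => h ⟨hω, h'⟩)).trans hq
  refine ⟨(toMeasurable P {ω | ¬ (p ω ∧ q ω)})ᶜ, (measurableSet_toMeasurable _ _).compl, ?_,
    fun ω hω => not_not.1 fun h => hω (subset_toMeasurable _ _ h)⟩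
  rw [prob_compl_eq_one_sub (measurableSet_toMeasurable _ _), measure_toMeasurable,
    ENNReal.ofReal_sub _ h0, ENNReal.ofReal_one]
  exact tsub_le_tsub_left hbad 1

theorem abs_pdist_mobLayer_sub_le (hs : 0 < s) (hCx : Cx < s) (h0 : 0 ≤ Cy) (hCy : Cy < s)
    {K L L' : Matrix (Fin dt) (Fin ds) ℝ} (hL : L ∈ Metric.closedBall K R)
    (hL' : L' ∈ Metric.closedBall K R) {x : E ds} (hx : ‖x‖ ≤ Cx) {z : E dt} (hz : ‖z‖ ≤ Cy) :
    |pdist s (mobLayer s L x) z - pdist s (mobLayer s L' x) z| ≤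
      pdistLip s (imageRadius s Cx Cy (‖K‖ + R)) * (3 * s * Real.artanh (Cx / s)) * dist L L' := by
  have hρ := imageRadius_lt (Cx := Cx) hs hCy (‖K‖ + R)
  have hLx := norm_mobLayer_le_imageRadius (Cy := Cy) hs hCx hL hx
  have hLx' := norm_mobLayer_le_imageRadius (Cy := Cy) hs hCx hL' hx
  calc |pdist s (mobLayer s L x) z - pdist s (mobLayer s L' x) z|
      ≤ pdist s (mobLayer s L x) (mobLayer s L' x) :=
        abs_pdist_sub_pdist_le hs (hLx.trans_lt hρ) (hLx'.trans_lt hρ) (hz.trans_lt hCy)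
    _ ≤ pdistLip s (imageRadius s Cx Cy (‖K‖ + R)) * ‖mobLayer s L x - mobLayer s L' x‖ :=
        pdist_le_pdistLip_mul hs hρ hLx hLx'
    _ ≤ pdistLip s (imageRadius s Cx Cy (‖K‖ + R)) *
          (3 * s * Real.artanh (Cx / s) * ‖L - L'‖) :=
        mul_le_mul_of_nonneg_left (norm_mobLayer_sub_le hs hCx L L' hx)
          (pdistLip_nonneg (h0.trans (le_imageRadius ..)) hρ)
    _ = pdistLip s (imageRadius s Cx Cy (‖K‖ + R)) * (3 * s * Real.artanh (Cx / s)) *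
          dist L L' := by rw [dist_eq_norm, ← mul_assoc]

theorem exists_forall_measure_deviation_mobLayer_le (hs : 0 < s) (hCx : Cx < s) (hCy : Cy < s)
    (K : Matrix (Fin dt) (Fin ds) ℝ) (hR : 0 < R) :
    ∃ C : ℝ, ∀ (μ : Measure (E ds)) [IsProbabilityMeasure μ] (B : E ds → E dt),
      (∀ᵐ x ∂μ, ‖x‖ ≤ Cx) → AEMeasurable B μ → (∀ᵐ x ∂μ, ‖B x‖ ≤ Cy) →
      ∀ n : ℕ, 0 < n → ∀ δ : ℝ, 0 < δ → δ < 1 →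
        Measure.pi (fun _ : Fin n => μ) {X | ¬ ∀ L ∈ Metric.closedBall K R,
            deviation μ X (fun x => pdist s (mobLayer s L x) (B x)) ≤
              C * (1 + √(Real.log (1 / δ))) / √(n : ℝ)} ≤ ENNReal.ofReal δ := by
  obtain ⟨M, N, hN⟩ := exists_isGeometricNet_closedBall K hR
  set ρ := imageRadius s Cx Cy (‖K‖ + R)
  have hρ : ρ < s := imageRadius_lt hs hCy _
  set A := pdistLip s ρ * (2 * ρ) + 1
  set Λ := pdistLip s ρ * (3 * s * Real.artanh (Cx / s))
  refine ⟨chainConst M (A + 3 * (2 * R) * Λ), ?_⟩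
  intro μ _ B hμ hB hBC n hn δ h0 h1
  obtain ⟨x, hx, hBx⟩ := (hμ.and hBC).exists
  have hCx0 : 0 ≤ Cx := (norm_nonneg x).trans hx
  have hCy0 : 0 ≤ Cy := (norm_nonneg _).trans hBx
  have hρ0 : 0 ≤ ρ := hCy0.trans (le_imageRadius ..)
  have hc0 := pdistLip_nonneg hρ0 hρ
  have hA0 : 0 < A := by positivity
  have hΛ0 : 0 ≤ Λ :=
    mul_nonneg hc0 (mul_nonneg (by positivity) (Real.artanh_nonneg (by positivity)))
  have hmeas : ∀ L ∈ Metric.closedBall K R,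
      AEMeasurable (fun x => pdist s (mobLayer s L x) (B x)) μ := fun L _ =>
    aemeasurable_pdist s (measurable_mobLayer s L).aemeasurable hB
  have hbound : ∀ᵐ x ∂μ, ∀ L ∈ Metric.closedBall K R,
      |pdist s (mobLayer s L x) (B x)| ≤ A := by
    filter_upwards [hμ, hBC] with x hx hBx L hL
    rw [abs_of_nonneg (pdist_nonneg hs.le _ _)]
    exact (pdist_le_pdistLip_mul_two_mul hs hρ (norm_mobLayer_le_imageRadius hs hCx hL hx)
      (hBx.trans (le_imageRadius ..))).trans (lt_add_one _).le
  have hlip : ∀ᵐ x ∂μ, ∀ L ∈ Metric.closedBall K R, ∀ L' ∈ Metric.closedBall K R,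
      |pdist s (mobLayer s L x) (B x) - pdist s (mobLayer s L' x) (B x)| ≤ Λ * dist L L' := by
    filter_upwards [hμ, hBC] with x hx hBx L hL L' hL'
    exact abs_pdist_mobLayer_sub_le hs hCx hCy0 hCy hL hL' hx hBx
  exact measure_not_forall_deviation_le hn h0 h1 hN hA0 (by positivity) hΛ0 hmeas hbound hlip

theorem exists_event_deviation_mobLayer_le (hs : 0 < s) (hCx : Cx < s) (hCy : Cy < s)
    (K : Matrix (Fin dt) (Fin ds) ℝ) (hR : 0 < R) :
    ∃ C : ℝ, 0 < C ∧ ∀ (μ : Measure (E ds)) [IsProbabilityMeasure μ] (B : E ds → E dt),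
      (∀ᵐ x ∂μ, ‖x‖ ≤ Cx) → AEMeasurable B μ → (∀ᵐ x ∂μ, ‖B x‖ ≤ Cy) →
      ∀ n : ℕ, 0 < n → ∀ δ : ℝ, 0 < δ → δ < 1 →
        ∃ G : Set (Fin n → E ds), MeasurableSet G ∧
          ENNReal.ofReal (1 - δ) ≤ Measure.pi (fun _ : Fin n => μ) G ∧
          ∀ X ∈ G, (∀ i, ‖X i‖ ≤ Cx ∧ ‖B (X i)‖ ≤ Cy) ∧ ∀ L ∈ Metric.closedBall K R,
            deviation μ X (fun x => pdist s (mobLayer s L x) (B x)) ≤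
              C * (1 + √(Real.log (1 / δ))) / √(n : ℝ) := by
  obtain ⟨C, hC⟩ := exists_forall_measure_deviation_mobLayer_le hs hCx hCy K hR
  refine ⟨max C 1, lt_max_of_lt_right one_pos, fun μ _ B hμ hB hBC n hn δ h0 h1 => ?_⟩
  have hX : ∀ᵐ X ∂Measure.pi fun _ : Fin n => μ, ∀ i, ‖X i‖ ≤ Cx ∧ ‖B (X i)‖ ≤ Cy :=
    ae_all_iff.2 fun i =>
      (Measure.quasiMeasurePreserving_eval (fun _ : Fin n => μ) i).ae (hμ.and hBC)
  obtain ⟨G, hG, hPG, h⟩ := exists_measurableSet_of_measure_not_le h0.le hX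
    (hC μ B hμ hB hBC n hn δ h0 h1)
  refine ⟨G, hG, hPG, fun X hX => ⟨(h X hX).1, fun L hL => ((h X hX).2 L hL).trans ?_⟩⟩
  gcongr
  exact le_max_left _ _

end Event

end Quality

end HypOT

end

open HypOT in
theorem theorem2_general (ds dt : ℕ) (s ω Cx Cy : ℝ) (K : Matrix (Fin dt) (Fin ds) ℝ)
    (hs : 0 < s) (hω : 0 < ω) (hCx : Cx < s) (hCy : Cy < s) :
    ∃ C : ℝ, 0 < C ∧ ∀ (M₀ : Measure (E ds × E dt)) [IsProbabilityMeasure M₀],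
      (∀ᵐ x ∂M₀.fst, ‖x‖ ≤ Cx) → (∀ᵐ y ∂M₀.snd, ‖y‖ ≤ Cy) →
      ∀ n : ℕ, 0 < n → ∀ δ : ℝ, 0 < δ → δ < 1 →
        ∃ G : Set (Fin n → E ds), MeasurableSet G ∧
          ENNReal.ofReal (1 - δ) ≤ Measure.pi (fun _ : Fin n => M₀.fst) G ∧
          ∀ X ∈ G, ∀ T : E ds → E dt, AEMeasurable T M₀.fst → (∀ᵐ x ∂M₀.fst, ‖T x‖ ≤ Cy) →
            ∀ (m : ℕ) (Xt : Fin m → E dt), (∀ j, ‖Xt j‖ ≤ Cy) →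
            ∀ M : Matrix (Fin n) (Fin m) ℝ, (∀ i j, 0 ≤ M i j) → (∀ i, 0 < ∑ j, M i j) →
            ∀ L : Matrix (Fin dt) (Fin ds) ℝ,
              qualityLoss s ω K X Xt M L ≤ qualityLoss s ω K X Xt M K →
              Integrable (fun x => pdist s (mobLayer s L x) (T x)) M₀.fst ∧
              Integrable (fun x => pdist s (T x) (gyroBaryPop s M₀ x)) M₀.fst ∧
              ∫ x, pdist s (mobLayer s L x) (T x) ∂M₀.fst ≤
                1 / (n : ℝ) * ∑ i, pdist s (mobLayer s L (X i)) (gyroBary s M Xt i)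
                + 1 / (n : ℝ) * ∑ i, pdist s (gyroBary s M Xt i) (gyroBaryPop s M₀ (X i))
                + ∫ x, pdist s (T x) (gyroBaryPop s M₀ x) ∂M₀.fst
                + C * (1 + √(Real.log (1 / δ))) / √(n : ℝ) := by
  obtain ⟨C, hC, hdev⟩ := exists_event_deviation_mobLayer_le hs hCx hCy K
    (learnedRadius_pos s ω Cx Cy K)
  refine ⟨C, hC, fun M₀ _ hμ hν n hn δ h0 h1 => ?_⟩
  have hCy0 : 0 ≤ Cy := hν.exists.elim fun y hy => (norm_nonneg y).trans hy
  have hB := (measurable_gyroBaryPop s M₀).aemeasurable (μ := M₀.fst)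
  have hBC := ae_norm_gyroBaryPop_le hCy0 hCy hν
  obtain ⟨G, hG, hPG, hdev⟩ := hdev M₀.fst _ hμ hB hBC n hn δ h0 h1
  refine ⟨G, hG, hPG, fun X hX T hT hTC m Xt hXt M hM _ L hL => ?_⟩
  obtain ⟨hXC, hdev⟩ := hdev X hX
  have hLball := mem_closedBall_of_qualityLoss_le hω hn hCy0 hCx hCy (fun i => (hXC i).1) hXt hM hL
  have hρ := imageRadius_lt (Cx := Cx) hs hCy
  have hCyρ := le_imageRadius s Cx Cy
  have hLρ {x} (hx : ‖x‖ ≤ Cx) := norm_mobLayer_le_imageRadius (Cy := Cy) hs hCx hLball hx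
  have hLm := (measurable_mobLayer s L).aemeasurable (μ := M₀.fst)
  exact ⟨integrable_pdist hs (hρ _) hLm hT (hμ.mono fun _ => hLρ)
      (hTC.mono fun _ h => h.trans (hCyρ _)),
    integrable_pdist hs hCy hT hB hTC hBC,
    integral_pdist_le_of_deviation_le hs (hρ _) hLm hT hB (hμ.mono fun _ => hLρ)
      (hTC.mono fun _ h => h.trans (hCyρ _)) (hBC.mono fun _ h => h.trans (hCyρ _))
      (fun i => hLρ (hXC i).1) (fun i => (hXC i).2.trans (hCyρ _))
      (fun i => (norm_gyroBary_le hCy0 hCy (hM i) hXt).trans (hCyρ _)) (hdev L hLball)⟩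

theorem theorem2 (ds dt : ℕ) (s ω Cx Cy : ℝ) (K : Matrix (Fin dt) (Fin ds) ℝ)
    (hs : 0 < s) (hω : 0 < ω) (hCx : Cx < s) (hCy : Cy < s) :
    ∃ C : ℝ, 0 < C ∧
      ∀ (μs : Measure (HypOT.E ds)) (μt : Measure (HypOT.E dt))
        (M₀ : Measure (HypOT.E ds × HypOT.E dt)) (Tstar : HypOT.E ds → HypOT.E dt)
        [IsProbabilityMeasure μs] [IsProbabilityMeasure μt] [IsProbabilityMeasure M₀],
        (∀ᵐ x ∂μs, ‖x‖ ≤ Cx) → (∀ᵐ y ∂μt, ‖y‖ ≤ Cy) →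
        -- `M₀` is a coupling of `μs` and `μt`, and `Tstar` transports `μs` to `μt`
        M₀.fst = μs → M₀.snd = μt → MeasurePreserving Tstar μs μt →
        ∀ (n : ℕ), 0 < n → ∀ (δ : ℝ), 0 < δ → δ < 1 →
          -- an event of probability at least `1 - δ` over `n` i.i.d. source samples
          ∃ G : Set (Fin n → HypOT.E ds), MeasurableSet G ∧
            ENNReal.ofReal (1 - δ) ≤ Measure.pi (fun _ : Fin n => μs) G ∧
            ∀ X ∈ G, ∀ (m : ℕ) (Xt : Fin m → HypOT.E dt), (∀ j, ‖Xt j‖ ≤ Cy) →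
              ∀ (a : Fin n → ℝ) (b : Fin m → ℝ),
                a ∈ stdSimplex ℝ (Fin n) → (∀ i, 0 < a i) → b ∈ stdSimplex ℝ (Fin m) →
              ∀ Mhat ∈ HypOT.couplings a b, ∀ L : Matrix (Fin dt) (Fin ds) ℝ,
                HypOT.IsLearned s ω K X Xt Mhat L →
                Integrable (fun x => HypOT.pdist s (HypOT.mobLayer s L x) (Tstar x)) μs ∧
                Integrable (fun x => HypOT.pdist s (Tstar x) (HypOT.gyroBaryPop s M₀ x)) μs ∧
                ∫ x, HypOT.pdist s (HypOT.mobLayer s L x) (Tstar x) ∂μs ≤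
                  1 / (n : ℝ) * ∑ i, HypOT.pdist s (HypOT.mobLayer s L (X i))
                      (HypOT.gyroBary s Mhat Xt i)
                  + 1 / (n : ℝ) * ∑ i, HypOT.pdist s (HypOT.gyroBary s Mhat Xt i)
                      (HypOT.gyroBaryPop s M₀ (X i))
                  + ∫ x, HypOT.pdist s (Tstar x) (HypOT.gyroBaryPop s M₀ x) ∂μs
                  + C * (1 + √(Real.log (1 / δ))) / √(n : ℝ) := by
  obtain ⟨C, hC, h⟩ := theorem2_general ds dt s ω Cx Cy K hs hω hCx hCy
  refine ⟨C, hC, ?_⟩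
  rintro μs μt M₀ T _ _ _ hμs hμt rfl rfl hT n hn δ h0 h1
  obtain ⟨G, hG, hPG, h⟩ := h M₀ hμs hμt n hn δ h0 h1
  exact ⟨G, hG, hPG, fun X hX m Xt hXt a b _ ha _ M hM L hL => h X hX T hT.measurable.aemeasurable
    (hT.quasiMeasurePreserving.ae hμt) m Xt hXt M hM.1 (fun i => hM.2.1 i ▸ ha i) L (hL K)⟩
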